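/- Let $A\to M$ be a Lie algebroid of rank $n$ over an $m$-dimensional (Hausdorff, smooth) manifold, with anchor $\rho$, let $\phi_0\in\Omega^1(A)$ be a $1$-cocycle ($d\phi_0=0$), and let $P\in\mathfrak X^2(A)$ be a Jacobi bivector on the Jacobi algebroid $(A,\phi_0)$, that is, $$[P,P]+2\,P^\sharp(\phi_0)\wedge P=0,\qquad \langle\beta,P^\sharp\alpha\rangle=P(\alpha,\beta).$$ Put $X_0=-P^\sharp(\phi_0)\in\Gamma(A)$, regarded as a $1$-form on $A^*$. With $d^{\phi_0}=d+\phi_0\wedge\cdot$ and $\mathcal L^{\phi_0}_X=i_Xd^{\phi_0}+d^{\phi_0}i_X$, the dual bundle $A^*$ carries the Lie algebroid structure with anchor $\rho\circ P^\sharp$ and bracket $$[\alpha,\beta]_P=\mathcal L^{\phi_0}_{P^\sharp\alpha}\beta-\mathcal L^{\phi_0}_{P^\sharp\beta}\alpha-d^{\phi_0}\big(P(\alpha,\beta)\big).$$ Let $\hat A=A\times\mathbb R\to M\times\mathbb R$ be the Lie algebroid whose bracket is that of $A$ on time-independent sections and whose anchor is $\hat\rho(X)=\rho(X)+\langle\phi_0,X\rangle\,\partial/\partial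 t$ (in both cases extended to time-dependent sections, by the Leibniz rule and by $C^\infty(M\times\mathbb R)$-linearity). Let $\hat A^*$ be its dual bundle with the Lie algebroid structure defined in the same way (with cocycle $0$) by the bivector $\tilde P=e^{-t}P$ on $\hat A$. For a Lie algebroid $B$ of rank $n$ over $N$ with anchor $\rho_B$, a nowhere vanishing $\eta\in\Gamma(\wedge^{n}B)$ and a volume form $\mu$ on $N$, the modular form $\xi_B^{\eta\otimes\mu}\in\Omega^1(B)$ is the unique $1$-form with $$\langle\xi_B^{\eta\otimes\mu},X\rangle\,\eta\otimes\mu=\mathcal L_X\eta\otimes\mu+\eta\otimes\mathcal L_{\rho_B(X)}\mu\quad\text{for all }X\in\Gamma(B),$$ and, for a $1$-cocycle $\phi$ of $B$, the modular form of the Jacobi algebroid $(B,\phi)$ is $\xi_B^{\phi,\eta\otimes\mu}=\xi_B^{\eta\otimes\mu}-(n-1)\phi$. Let $\nu\in\Gamma(\wedge^nA^*)$ be a nowhere vanishing section and $\mu$ a volume form on $M$. Put $\hat\nu=e^{nt}\nu$ and $\tilde\mu=\mu\wedge dt$. Then the modular forms $\xi_{A^*}^{\nu\otimes\mu}$, $\xi_{\hat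 A^*}^{\hat\nu\otimes\tilde\mu}$ and $\xi_{\hat A^*}^{\nu\otimes\tilde\mu}$ exist and are unique, and: 1. the modular form of the Lie algebroid $A^*$ satisfies $$\xi_{A^*}^{\nu\otimes\mu}=e^{t}\,\xi_{\hat A^*}^{\hat\nu\otimes\tilde\mu};$$ 2. the modular form of the Jacobi algebroid $(A^*,X_0)$ satisfies $$\xi_{A^*}^{X_0,\nu\otimes\mu}=e^{t}\,\xi_{\hat A^*}^{\nu\otimes\tilde\mu}+X_0.$$ Here objects on $A^*$ and $M$ are viewed as time-independent objects on $\hat A^*$ and $M\times\mathbb R$; in particular both identities hold after evaluation at every $\alpha\in\Gamma(A^*)$. -/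

import Mathlib

open Bundle Manifold ContDiff
open scoped Topology

noncomputable section

namespace LieAlgd

set_option linter.unusedSectionVars false

section Basic

variable {E : Type*} [NormedAddCommGroup E] [NormedSpace ℝ E]
  {H : Type*} [TopologicalSpace H] (I : ModelWithCorners ℝ E H)
  (M : Type*) [TopologicalSpace M] [ChartedSpace H M]

/-- The ring `C^∞(M)` of smooth real functions. -/
abbrev Fn : Type _ := C^∞⟮I, M; 𝓘(ℝ, ℝ), ℝ⟯

variable (F : Type*) [NormedAddCommGroup F] [NormedSpace ℝ F]
  {M} (V : M → Type*) [TopologicalSpace (TotalSpace F V)]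
  [∀ x, AddCommGroup (V x)] [∀ x, Module ℝ (V x)] [∀ x, TopologicalSpace (V x)]
  [FiberBundle F V] [VectorBundle ℝ F V]

/-- The module `Γ(V)` of smooth sections of a vector bundle. -/
abbrev Sec : Type _ := Cₛ^∞⟮I; F, V⟯

variable {I F V}

instance instSMulFnSec : SMul (Fn I M) (Sec I F V) :=
  ⟨fun f s => ⟨fun x => f x • s x, ContMDiff.smul_section f.contMDiff s.contMDiff⟩⟩

@[simp] theorem fn_smul_apply (f : Fn I M) (s : Sec I F V) (x : M) : (f • s) x = f x • s x := rfl

/-- `Γ(V)` is a module over `C^∞(M)`. -/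
instance instModuleFnSec : Module (Fn I M) (Sec I F V) where
  one_smul s := by ext x; exact one_smul ℝ (s x)
  mul_smul f g s := by ext x; exact mul_smul (f x) (g x) (s x)
  smul_zero f := by ext x; exact smul_zero (f x)
  smul_add f s t := by ext x; exact smul_add (f x) (s x) (t x)
  add_smul f g s := by ext x; exact add_smul (f x) (g x) (s x)
  zero_smul s := by ext x; exact zero_smul ℝ (s x)

/-- Evaluation of sections at a point is additive. -/
def evalSec (x : M) : Sec I F V →+ V x where
  toFun s := s x
  map_zero' := rfl
  map_add' _ _ := rfl

theorem sec_sum_apply {ι : Type*} (t : Finset ι) (s : ι → Sec I F V) (x : M) :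
    (∑ i ∈ t, s i) x = ∑ i ∈ t, s i x := map_sum (evalSec x) s t

/-- Evaluation of functions at a point is additive. -/
theorem fn_sum_apply {ι : Type*} (t : Finset ι) (f : ι → Fn I M) (x : M) :
    (∑ i ∈ t, f i) x = ∑ i ∈ t, f i x :=
  map_sum (ContMDiffMap.evalRingHom (I := I) (n := ∞) (R := ℝ) (I' := 𝓘(ℝ, ℝ)) x) f t

variable [IsManifold I ∞ M]

variable (I M) in
/-- The module `𝔛(M)` of smooth vector fields. -/
abbrev VF : Type _ := Sec I E (TangentSpace I : M → Type _)

/-- The derivative `Z f` of a function along a vector field. -/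
def VF.deriv (Z : VF I M) (f : Fn I M) : Fn I M :=
  ⟨fun x => mvfderiv I f x (Z x), by
    have h := (contMDiff_snd_tangentBundle_modelSpace (n := ∞) ℝ 𝓘(ℝ, ℝ)).comp
      ((f.contMDiff.contMDiff_tangentMap (m := ∞) le_rfl).comp Z.contMDiff)
    exact h⟩

/-- The Lie bracket of vector fields. -/
def VF.lie [CompleteSpace E] (Z W : VF I M) : VF I M :=
  ⟨VectorField.mlieBracket I Z W, by
    have : IsManifold I (minSmoothness ℝ 2) M := by
      rw [minSmoothness_of_isRCLikeNormedField]; infer_instance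
    have : IsManifold I (((⊤ : ℕ∞) : WithTop ℕ∞) + 1) M := by
      change IsManifold I ∞ M
      infer_instance
    have := ContDiff.mlieBracket_vectorField (m := ⊤) (n := ⊤) Z.contMDiff W.contMDiff
      (by simp [minSmoothness_of_isRCLikeNormedField])
    exact this⟩

theorem VF.deriv_apply (Z : VF I M) (f : Fn I M) (x : M) :
    Z.deriv f x = mvfderiv I f x (Z x) := rfl

theorem VF.deriv_add (Z : VF I M) (f g : Fn I M) : Z.deriv (f + g) = Z.deriv f + Z.deriv g := by
  ext x
  have hf : MDifferentiableAt I 𝓘(ℝ, ℝ) f x := f.mdifferentiableAt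
  have hg : MDifferentiableAt I 𝓘(ℝ, ℝ) g x := g.mdifferentiableAt
  have := mvfderiv_add hf hg
  simp only [VF.deriv_apply, ContMDiffMap.coe_add, Pi.add_apply]
  rw [this]; rfl

theorem VF.deriv_mul (Z : VF I M) (f g : Fn I M) :
    Z.deriv (f * g) = f * Z.deriv g + g * Z.deriv f := by
  ext x
  have hf : MDifferentiableAt I 𝓘(ℝ, ℝ) f x := f.mdifferentiableAt
  have hg : MDifferentiableAt I 𝓘(ℝ, ℝ) g x := g.mdifferentiableAt
  have := mvfderiv_mul hf hg
  simp only [VF.deriv_apply, ContMDiffMap.coe_add, ContMDiffMap.coe_mul, Pi.add_apply, Pi.mul_apply]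
  rw [this]; rfl

theorem VF.add_deriv (Z W : VF I M) (f : Fn I M) : (Z + W).deriv f = Z.deriv f + W.deriv f := by
  ext x; exact map_add (mvfderiv I f x) (Z x) (W x)

theorem VF.smul_deriv (g : Fn I M) (Z : VF I M) (f : Fn I M) : (g • Z).deriv f = g * Z.deriv f := by
  ext x; exact map_smul (mvfderiv I f x) (g x) (Z x)

theorem VF.lie_add [CompleteSpace E] (Z W W' : VF I M) : Z.lie (W + W') = Z.lie W + Z.lie W' := by
  ext x
  exact VectorField.mlieBracket_add_right W.mdifferentiableAt W'.mdifferentiableAt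

theorem VF.add_lie [CompleteSpace E] (Z Z' W : VF I M) : (Z + Z').lie W = Z.lie W + Z'.lie W := by
  ext x
  exact VectorField.mlieBracket_add_left Z.mdifferentiableAt Z'.mdifferentiableAt

theorem VF.lie_self [CompleteSpace E] (Z : VF I M) : Z.lie Z = 0 := by
  ext x
  exact congrFun (VectorField.mlieBracket_self (I := I) (V := ⇑Z)) x

theorem VF.lie_smul [CompleteSpace E] (Z : VF I M) (f : Fn I M) (W : VF I M) :
    Z.lie (f • W) = f • Z.lie W + Z.deriv f • W := by
  ext x
  have := VectorField.mlieBracket_smul_right (I := I) (V := ⇑Z) (W := ⇑W) (f := ⇑f) (x := x)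
    f.mdifferentiableAt W.mdifferentiableAt
  exact this.trans (add_comm _ _)

end Basic

section Algebroid

variable {E : Type*} [NormedAddCommGroup E] [NormedSpace ℝ E]
  {H : Type*} [TopologicalSpace H] (I : ModelWithCorners ℝ E H)
  (M : Type*) [TopologicalSpace M] [ChartedSpace H M] [IsManifold I ∞ M]

/-- A skew bracket and an anchor on the `C^∞(M)`-module `S` of sections of a vector bundle over `M`,
related by the Leibniz rule: a Lie algebroid up to the Jacobi identity. -/
structure AlmostLieAlgebroid (S : Type*) [AddCommGroup S] [Module (Fn I M) S] where
  bracket : S → S → S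
  anchor : S →ₗ[Fn I M] VF I M
  bracket_self : ∀ X, bracket X X = 0
  bracket_add : ∀ X Y Z, bracket X (Y + Z) = bracket X Y + bracket X Z
  add_bracket : ∀ X Y Z, bracket (X + Y) Z = bracket X Z + bracket Y Z
  bracket_smul : ∀ X (f : Fn I M) Y,
    bracket X (f • Y) = f • bracket X Y + (anchor X).deriv f • Y

/-- A Lie algebroid, given on the module `S` of sections. -/
structure LieAlgebroid (S : Type*) [AddCommGroup S] [Module (Fn I M) S]
    extends AlmostLieAlgebroid I M S where
  jacobi : ∀ X Y Z, bracket X (bracket Y Z) + bracket Y (bracket Z X) + bracket Z (bracket X Y) = 0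

variable {I M} {S : Type*} [AddCommGroup S] [Module (Fn I M) S]

variable (I M S) in
/-- `Ω¹(A) = Γ(A*)`: the `C^∞(M)`-linear functionals on sections of `A`. -/
abbrev Dual : Type _ := S →ₗ[Fn I M] Fn I M

variable (I M S) in
/-- `Ωᵏ(A)`: the alternating `C^∞(M)`-multilinear functionals on sections of `A`. -/
abbrev Form (k : ℕ) : Type _ := S [⋀^Fin k]→ₗ[Fn I M] Fn I M

variable (I M S) in
/-- `𝔛ᵏ(A)`: the alternating `C^∞(M)`-multilinear functionals on sections of `A*`. -/
abbrev Multivector (k : ℕ) : Type _ := Form I M (Dual I M S) k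

variable (I M S) in
/-- A bivector `P` on `A`, given by the skew map `P^♯ : A* → A`, `⟨β, P^♯ α⟩ = P(α, β)`. -/
structure Bivector where
  sharp : Dual I M S →ₗ[Fn I M] S
  skew : ∀ α β : Dual I M S, β (sharp α) = - α (sharp β)

namespace Bivector

/-- The value `P(α, β)`. -/
def val (P : Bivector I M S) (α β : Dual I M S) : Fn I M := β (P.sharp α)

instance : SMul (Fn I M) (Bivector I M S) :=
  ⟨fun f P => ⟨f • P.sharp, fun α β => by simp [P.skew α β]⟩⟩

end Bivector

namespace AlmostLieAlgebroid

variable (A : AlmostLieAlgebroid I M S)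

theorem bracket_swap (X Y : S) : A.bracket X Y = - A.bracket Y X := by
  have h := A.bracket_self (X + Y)
  rw [A.bracket_add, A.add_bracket, A.add_bracket, A.bracket_self, A.bracket_self] at h
  rw [eq_neg_iff_add_eq_zero]
  simpa [add_comm] using h

theorem smul_bracket (f : Fn I M) (X Y : S) :
    A.bracket (f • X) Y = f • A.bracket X Y - (A.anchor Y).deriv f • X := by
  rw [A.bracket_swap, A.bracket_smul, A.bracket_swap Y X]
  simp [sub_eq_add_neg, add_comm]

/-- The differential of a function: `⟨d f, Y⟩ = ρ(Y) f`. -/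
def d₀ (f : Fn I M) : Dual I M S where
  toFun Y := (A.anchor Y).deriv f
  map_add' X Y := by rw [map_add, VF.add_deriv]
  map_smul' g X := by rw [map_smul, VF.smul_deriv]; rfl

/-- The differential of a `1`-form. -/
def d₁ (α : Dual I M S) (X Y : S) : Fn I M :=
  (A.anchor X).deriv (α Y) - (A.anchor Y).deriv (α X) - α (A.bracket X Y)

/-- `φ` is a `1`-cocycle: `d φ = 0`. -/
def IsCocycle (φ : Dual I M S) : Prop := ∀ X Y, A.d₁ φ X Y = 0

/-- The `φ`-differential `d^φ f = d f + f φ` of a function. -/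
def dTw₀ (φ : Dual I M S) (f : Fn I M) : Dual I M S := A.d₀ f + f • φ

/-- The `φ`-differential `d^φ α = d α + φ ∧ α` of a `1`-form. -/
def dTw₁ (φ : Dual I M S) (α : Dual I M S) (X Y : S) : Fn I M :=
  A.d₁ α X Y + (φ X * α Y - φ Y * α X)

/-- The `φ`-Lie derivative `ℒ^φ_X α = i_X d^φ α + d^φ i_X α` of a `1`-form. -/
def lieTw (φ : Dual I M S) (X : S) (α : Dual I M S) : Dual I M S where
  toFun Y := A.dTw₁ φ α X Y + A.dTw₀ φ (α X) Y
  map_add' Y Z := by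
    simp only [dTw₁, dTw₀, d₁, d₀, LinearMap.add_apply, LinearMap.smul_apply, LinearMap.coe_mk,
      AddHom.coe_mk, smul_eq_mul, map_add, VF.deriv_add, VF.add_deriv, A.bracket_add]
    ring
  map_smul' f Y := by
    simp only [dTw₁, dTw₀, d₁, d₀, LinearMap.add_apply, LinearMap.smul_apply, LinearMap.coe_mk,
      AddHom.coe_mk, smul_eq_mul, map_add, map_smul, VF.deriv_mul, VF.smul_deriv, A.bracket_smul,
      RingHom.id_apply]
    ring

theorem lieTw_apply (φ : Dual I M S) (X : S) (α : Dual I M S) (Y : S) :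
    A.lieTw φ X α Y = (A.anchor X).deriv (α Y) - α (A.bracket X Y) + φ X * α Y := by
  simp only [lieTw, dTw₁, dTw₀, d₁, d₀, LinearMap.add_apply, LinearMap.smul_apply,
    LinearMap.coe_mk, AddHom.coe_mk, smul_eq_mul]
  ring

/-- The Lie derivative `ℒ_X α` of a `1`-form. -/
def lieDual (X : S) (α : Dual I M S) : Dual I M S := A.lieTw 0 X α

/-- The values of the Lie derivative `ℒ_X κ` of a `k`-form. -/
def lieForm {k : ℕ} (X : S) (κ : Form I M S k) (Y : Fin k → S) : Fn I M :=
  (A.anchor X).deriv (κ Y) - ∑ i, κ (Function.update Y i (A.bracket X (Y i)))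

/-- The values of the Lie derivative (Schouten bracket) `ℒ_X η = [X, η]` of a `k`-vector. -/
def lieMultivector {k : ℕ} (X : S) (η : Multivector I M S k) (θ : Fin k → Dual I M S) : Fn I M :=
  (A.anchor X).deriv (η θ) - ∑ i, η (Function.update θ i (A.lieDual X (θ i)))

/-- The Schouten square `[P, P]` of a bivector, evaluated on three `1`-forms. -/
def schoutenSq (P : Bivector I M S) (α β γ : Dual I M S) : Fn I M :=
  2 * ((γ (A.bracket (P.sharp α) (P.sharp β)) - (A.anchor (P.sharp α)).deriv (P.val β γ)) +
    (α (A.bracket (P.sharp β) (P.sharp γ)) - (A.anchor (P.sharp β)).deriv (P.val γ α)) +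
    (β (A.bracket (P.sharp γ) (P.sharp α)) - (A.anchor (P.sharp γ)).deriv (P.val α β)))

/-- `X ∧ P` evaluated on three `1`-forms. -/
def wedgeBivector (X : S) (P : Bivector I M S) (α β γ : Dual I M S) : Fn I M :=
  α X * P.val β γ + β X * P.val γ α + γ X * P.val α β

/-- `P` is a Jacobi bivector on `(A, φ)`: the Schouten-Jacobi bracket
`[P, P]^φ = [P, P] + P ∧ i_φ P + i_φ P ∧ P = [P, P] + 2 P^♯(φ) ∧ P` vanishes. -/
def IsJacobiBivector (φ : Dual I M S) (P : Bivector I M S) : Prop :=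
  ∀ α β γ, A.schoutenSq P α β γ + 2 * wedgeBivector (P.sharp φ) P α β γ = 0

/-- The structure on `A*` defined by `φ` and `P`: the bracket
`[α, β]_P = ℒ^φ_{P^♯ α} β - ℒ^φ_{P^♯ β} α - d^φ (P(α, β))` and the anchor `ρ ∘ P^♯`. -/
def dual (φ : Dual I M S) (P : Bivector I M S) : AlmostLieAlgebroid I M (Dual I M S) where
  bracket α β := A.lieTw φ (P.sharp α) β - A.lieTw φ (P.sharp β) α - A.dTw₀ φ (P.val α β)
  anchor := A.anchor ∘ₗ P.sharp
  bracket_self α := by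
    have h : P.val α α = 0 := by
      ext x
      have := congrArg (fun f : Fn I M => f x) (P.skew α α)
      simp only [ContMDiffMap.coe_neg, Pi.neg_apply] at this
      have h0 : (P.val α α) x = α (P.sharp α) x := rfl
      rw [h0]
      change _ = (0 : ℝ)
      linarith
    have h0 : A.d₀ (0 : Fn I M) = 0 := by
      ext Y : 1
      change (A.anchor Y).deriv 0 = 0
      have := VF.deriv_add (A.anchor Y) 0 0
      simpa using this
    rw [h, dTw₀, h0]
    simp
  bracket_add α β γ := by
    ext Y : 1
    simp only [LinearMap.sub_apply, LinearMap.add_apply, lieTw_apply, dTw₀, d₀, map_add,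
      Bivector.val, A.add_bracket, VF.add_deriv, VF.deriv_add, LinearMap.smul_apply,
      LinearMap.coe_mk, AddHom.coe_mk, smul_eq_mul]
    ring
  add_bracket α β γ := by
    ext Y : 1
    simp only [LinearMap.sub_apply, LinearMap.add_apply, lieTw_apply, dTw₀, d₀, map_add,
      Bivector.val, A.add_bracket, VF.add_deriv, VF.deriv_add, LinearMap.smul_apply,
      LinearMap.coe_mk, AddHom.coe_mk, smul_eq_mul]
    ring
  bracket_smul α f β := by
    ext Y : 1
    have h := P.skew α β
    simp only [LinearMap.sub_apply, LinearMap.add_apply, lieTw_apply, dTw₀, d₀, map_smul,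
      Bivector.val, A.smul_bracket, VF.smul_deriv, VF.deriv_mul, LinearMap.smul_apply,
      LinearMap.coe_mk, AddHom.coe_mk, smul_eq_mul, map_sub, LinearMap.comp_apply, h]
    ring

end AlmostLieAlgebroid

variable (I M) in
/-- The tangent Lie algebroid. -/
def tangentAlgebroid [CompleteSpace E] : AlmostLieAlgebroid I M (VF I M) where
  bracket := VF.lie
  anchor := LinearMap.id
  bracket_self := VF.lie_self
  bracket_add := VF.lie_add
  add_bracket := VF.add_lie
  bracket_smul := VF.lie_smul

/-- `ξ` is the modular form of `A` with respect to `η ⊗ μ`: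
`⟨ξ, X⟩ η ⊗ μ = ℒ_X η ⊗ μ + η ⊗ ℒ_{ρ(X)} μ` for all sections `X`. -/
def IsModularForm [CompleteSpace E] (A : AlmostLieAlgebroid I M S) {n m : ℕ}
    (η : Multivector I M S n) (μ : Form I M (VF I M) m) (ξ : Dual I M S) : Prop :=
  ∀ (X : S) (θ : Fin n → Dual I M S) (Z : Fin m → VF I M),
    ξ X * (η θ * μ Z) =
      A.lieMultivector X η θ * μ Z + η θ * (tangentAlgebroid I M).lieForm (A.anchor X) μ Z

end Algebroid

section Time

variable {E : Type*} [NormedAddCommGroup E] [NormedSpace ℝ E]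
  {H : Type*} [TopologicalSpace H] {I : ModelWithCorners ℝ E H}
  {M : Type*} [TopologicalSpace M] [ChartedSpace H M]

variable (I M) in
/-- The ring `C^∞(M × ℝ)`. -/
abbrev FnT : Type _ := Fn (I.prod 𝓘(ℝ, ℝ)) (M × ℝ)

/-- The function `f(·, t)`. -/
def fnSlice (t : ℝ) (f : FnT I M) : Fn I M :=
  ⟨fun x => f (x, t), f.contMDiff.comp (contMDiff_id.prodMk contMDiff_const)⟩

/-- A function on `M` as a function on `M × ℝ`. -/
def fnConst (f : Fn I M) : FnT I M := ⟨fun p => f p.1, f.contMDiff.comp contMDiff_fst⟩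

variable (I M) in
/-- The coordinate `t` on `M × ℝ`. -/
def timeFn : FnT I M := ⟨fun p => p.2, contMDiff_snd⟩

variable (I M) in
/-- The function `e^{ct}` on `M × ℝ`. -/
def expFn (c : ℝ) : FnT I M :=
  ⟨fun p => Real.exp (c * p.2),
    (Real.contDiff_exp.comp (contDiff_const.mul contDiff_id)).contMDiff.comp contMDiff_snd⟩

theorem contMDiffFn_of_bump {g : M × ℝ → ℝ}
    (h : ∀ x₀ : M, ∃ χ : Fn I M, χ x₀ ≠ 0 ∧ ∃ k : FnT I M, ∀ p : M × ℝ, χ p.1 * g p = k p) :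
    ContMDiff (I.prod 𝓘(ℝ, ℝ)) 𝓘(ℝ, ℝ) ∞ g := by
  intro p₀
  obtain ⟨χ, hχ, k, hk⟩ := h p₀.1
  have hc : ContMDiffAt (I.prod 𝓘(ℝ, ℝ)) 𝓘(ℝ, ℝ) ∞ (fun p : M × ℝ => χ p.1) p₀ :=
    (fnConst χ).contMDiff p₀
  have h1 := ContMDiffAt.smul (hc.inv₀ hχ) (k.contMDiff p₀)
  refine h1.congr_of_eventuallyEq ?_
  filter_upwards [hc.continuousAt.eventually_ne hχ] with p hp
  change g p = (χ p.1)⁻¹ * k p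
  rw [← hk p]
  field_simp

theorem contMDiffSec_of_bump {F : Type*} [NormedAddCommGroup F] [NormedSpace ℝ F]
    {W : M × ℝ → Type*} [TopologicalSpace (TotalSpace F W)]
    [∀ x, AddCommGroup (W x)] [∀ x, Module ℝ (W x)] [∀ x, TopologicalSpace (W x)]
    [FiberBundle F W] [VectorBundle ℝ F W] {g : ∀ p, W p}
    (h : ∀ x₀ : M, ∃ χ : Fn I M, χ x₀ ≠ 0 ∧ ∃ k : Sec (I.prod 𝓘(ℝ, ℝ)) F W,
      ∀ p : M × ℝ, χ p.1 • g p = k p) :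
    ContMDiff (I.prod 𝓘(ℝ, ℝ)) ((I.prod 𝓘(ℝ, ℝ)).prod 𝓘(ℝ, F)) ∞
      (fun p => TotalSpace.mk' F p (g p)) := by
  intro p₀
  obtain ⟨χ, hχ, k, hk⟩ := h p₀.1
  have hc : ContMDiffAt (I.prod 𝓘(ℝ, ℝ)) 𝓘(ℝ, ℝ) ∞ (fun p : M × ℝ => χ p.1) p₀ :=
    (fnConst χ).contMDiff p₀
  have h1 := ContMDiffAt.smul_section (hc.inv₀ hχ) (k.contMDiff p₀)
  refine h1.congr_of_eventuallyEq ?_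
  filter_upwards [hc.continuousAt.eventually_ne hχ] with p hp
  refine congrArg (TotalSpace.mk' F p) ?_
  change g p = (χ p.1)⁻¹ • k p
  rw [← hk p, smul_smul, inv_mul_cancel₀ hp, one_smul]

variable (I M) in
/-- The relation between the `C^∞(M)`-module `S` of sections of a bundle of rank `r` over `M` and
the `C^∞(M × ℝ)`-module `T` of its time-dependent sections: freezing the time, viewing a section as
a time-independent one, and compatible local frames. -/
structure TimeExt (r : ℕ) (S T : Type*) [AddCommGroup S] [Module (Fn I M) S]
    [AddCommGroup T] [Module (FnT I M) T] where
  slice : ℝ → T →+ S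
  const : S →+ T
  slice_smul : ∀ (t : ℝ) (f : FnT I M) (X : T), slice t (f • X) = fnSlice t f • slice t X
  const_smul : ∀ (f : Fn I M) (X : S), const (f • X) = fnConst f • const X
  slice_const : ∀ t X, slice t (const X) = X
  frame : ∀ x₀ : M, ∃ (χ : Fn I M) (s : Fin r → S) (c : Fin r → (S →ₗ[Fn I M] Fn I M))
    (c' : Fin r → (T →ₗ[FnT I M] FnT I M)), χ x₀ ≠ 0 ∧
      (∀ X, χ • X = ∑ j, c j X • s j) ∧
      (∀ X, fnConst χ • X = ∑ j, c' j X • const (s j)) ∧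
      ∀ j X t, fnSlice t (c' j X) = c j (slice t X)

namespace TimeExt

variable {r : ℕ} {S T : Type*} [AddCommGroup S] [Module (Fn I M) S]
    [AddCommGroup T] [Module (FnT I M) T] (e : TimeExt I M r S T)

theorem fnSlice_sum {ι : Type*} (u : Finset ι) (t : ℝ) (f : ι → FnT I M) :
    fnSlice t (∑ i ∈ u, f i) = ∑ i ∈ u, fnSlice t (f i) := by
  ext x
  rw [fn_sum_apply]
  exact fn_sum_apply _ _ _

/-- The local frame expansion of a time-dependent section, at a fixed time. -/
theorem slice_frame {χ : Fn I M} {s : Fin r → S}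
    {c' : Fin r → (T →ₗ[FnT I M] FnT I M)}
    (h : ∀ X, fnConst χ • X = ∑ j, c' j X • e.const (s j)) (t : ℝ) (X : T) :
    χ • e.slice t X = ∑ j, fnSlice t (c' j X) • s j := by
  have h1 := congrArg (e.slice t) (h X)
  rw [e.slice_smul, map_sum] at h1
  simp only [e.slice_smul, e.slice_const] at h1
  exact h1

/-- A `k`-form on `A`, pulled back to the time-dependent sections. -/
def constForm {k : ℕ} (κ : S [⋀^Fin k]→ₗ[Fn I M] Fn I M) :
    T [⋀^Fin k]→ₗ[FnT I M] FnT I M where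
  toFun X := ⟨fun p => κ (fun i => e.slice p.2 (X i)) p.1, by
    refine contMDiffFn_of_bump fun x₀ => ?_
    obtain ⟨χ, s, c, c', hχ, -, h', -⟩ := e.frame x₀
    refine ⟨χ ^ k, by simpa using pow_ne_zero k hχ,
      ∑ J : Fin k → Fin r, (∏ i, c' (J i) (X i)) * fnConst (κ fun i => s (J i)), fun p => ?_⟩
    have h2 : χ ^ k * κ (fun i => e.slice p.2 (X i)) =
        ∑ J : Fin k → Fin r, (∏ i, fnSlice p.2 (c' (J i) (X i))) * κ fun i => s (J i) := by
      have h3 := κ.toMultilinearMap.map_smul_univ (fun _ => χ) (fun i => e.slice p.2 (X i))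
      simp only [Finset.prod_const, Finset.card_univ, Fintype.card_fin, smul_eq_mul] at h3
      rw [show χ ^ k * κ (fun i => e.slice p.2 (X i)) = _ from h3.symm]
      simp only [e.slice_frame h']
      rw [MultilinearMap.map_sum]
      refine Finset.sum_congr rfl fun J _ => ?_
      rw [MultilinearMap.map_smul_univ]
      rfl
    have h4 := congrArg (fun f : Fn I M => f p.1) h2
    simp only [fn_sum_apply] at h4 ⊢
    refine h4.trans (Finset.sum_congr rfl fun J _ => ?_)
    change (∏ i, fnSlice p.2 (c' (J i) (X i))) p.1 * _ = (∏ i, c' (J i) (X i)) p * _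
    congr 1
    have e1 := map_prod (ContMDiffMap.evalRingHom (I := I) (n := ∞) (R := ℝ) (I' := 𝓘(ℝ, ℝ)) p.1)
      (fun i => fnSlice p.2 (c' (J i) (X i))) Finset.univ
    have e2 := map_prod (ContMDiffMap.evalRingHom (I := I.prod 𝓘(ℝ, ℝ)) (n := ∞) (R := ℝ)
      (I' := 𝓘(ℝ, ℝ)) p) (fun i => c' (J i) (X i)) Finset.univ
    exact e1.trans e2.symm⟩
  map_update_add' X i Y Z := by
    ext p
    have h (W : T) : (fun j => e.slice p.2 (Function.update X i W j)) =
        Function.update (fun j => e.slice p.2 (X j)) i (e.slice p.2 W) := by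
      ext j; by_cases hj : j = i
      · subst hj; simp
      · simp [hj]
    change (κ fun j => e.slice p.2 (Function.update X i (Y + Z) j)) p.1 =
      (κ fun j => e.slice p.2 (Function.update X i Y j)) p.1 +
      (κ fun j => e.slice p.2 (Function.update X i Z j)) p.1
    simp only [h, map_add, AlternatingMap.map_update_add]
    rfl
  map_update_smul' X i f Y := by
    ext p
    have h (W : T) : (fun j => e.slice p.2 (Function.update X i W j)) =
        Function.update (fun j => e.slice p.2 (X j)) i (e.slice p.2 W) := by
      ext j; by_cases hj : j = i
      · subst hj; simp
      · simp [hj]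
    change (κ fun j => e.slice p.2 (Function.update X i (f • Y) j)) p.1 =
      f p * (κ fun j => e.slice p.2 (Function.update X i Y j)) p.1
    simp only [h, e.slice_smul, AlternatingMap.map_update_smul]
    rfl
  map_eq_zero_of_eq' X i j hX hij := by
    ext p
    change (κ fun i => e.slice p.2 (X i)) p.1 = 0
    rw [κ.map_eq_zero_of_eq _ (by simp [hX]) hij]
    rfl

/-- A `1`-form on `A` as a time-independent `1`-form. -/
def constDual (α : S →ₗ[Fn I M] Fn I M) : T →ₗ[FnT I M] FnT I M where
  toFun X := ⟨fun p => α (e.slice p.2 X) p.1, by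
    refine contMDiffFn_of_bump fun x₀ => ?_
    obtain ⟨χ, s, c, c', hχ, -, h', -⟩ := e.frame x₀
    refine ⟨χ, hχ, ∑ j, c' j X * fnConst (α (s j)), fun p => ?_⟩
    have h2 := congrArg (fun f : Fn I M => f p.1) (congrArg α (e.slice_frame h' p.2 X))
    simp only [map_smul, map_sum, fn_sum_apply] at h2 ⊢
    exact h2⟩
  map_add' X Y := by
    ext p
    change α (e.slice p.2 (X + Y)) p.1 = α (e.slice p.2 X) p.1 + α (e.slice p.2 Y) p.1
    rw [map_add, map_add]; rfl
  map_smul' f X := by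
    ext p
    change α (e.slice p.2 (f • X)) p.1 = f p * α (e.slice p.2 X) p.1
    rw [e.slice_smul, map_smul]; rfl

/-- A time-dependent `1`-form at a fixed time. -/
def sliceDual (t : ℝ) (α : T →ₗ[FnT I M] FnT I M) : S →ₗ[Fn I M] Fn I M where
  toFun X := fnSlice t (α (e.const X))
  map_add' X Y := by rw [map_add, map_add]; rfl
  map_smul' f X := by rw [e.const_smul, map_smul]; rfl

/-- Time-dependent sections of the dual bundle. -/
def dual : TimeExt I M r (S →ₗ[Fn I M] Fn I M) (T →ₗ[FnT I M] FnT I M) where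
  slice t := { toFun := e.sliceDual t, map_zero' := rfl, map_add' := fun _ _ => rfl }
  const := { toFun := e.constDual, map_zero' := rfl, map_add' := fun _ _ => rfl }
  slice_smul _ _ _ := rfl
  const_smul _ _ := rfl
  slice_const t α := by
    ext X x
    change α (e.slice t (e.const X)) x = α X x
    rw [e.slice_const]
  frame x₀ := by
    obtain ⟨χ, s, c, c', hχ, h, h', hc⟩ := e.frame x₀
    have hc2 (j X) : e.constDual (c j) X = c' j X := by
      ext p
      exact (congrArg (fun f : Fn I M => f p.1) (hc j X p.2)).symm
    refine ⟨χ, c, fun j => LinearMap.applyₗ (s j), fun j => LinearMap.applyₗ (e.const (s j)),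
      hχ, fun α => ?_, fun α => ?_, fun j α t => rfl⟩
    · ext X : 1
      rw [LinearMap.smul_apply, ← map_smul, h X, map_sum, LinearMap.sum_apply]
      refine Finset.sum_congr rfl fun j _ => ?_
      simp [mul_comm]
    · ext X : 1
      rw [LinearMap.smul_apply, ← map_smul, h' X, map_sum, LinearMap.sum_apply]
      refine Finset.sum_congr rfl fun j _ => ?_
      change _ = LinearMap.applyₗ (e.const (s j)) α * e.constDual (c j) X
      rw [hc2]
      simp [mul_comm]

end TimeExt

end Time

section Frames

variable {E : Type*} [NormedAddCommGroup E] [NormedSpace ℝ E]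
  {H : Type*} [TopologicalSpace H] {I : ModelWithCorners ℝ E H}
  {M : Type*} [TopologicalSpace M] [ChartedSpace H M]
  {F : Type*} [NormedAddCommGroup F] [NormedSpace ℝ F] [FiniteDimensional ℝ F]
  {V : M → Type*} [TopologicalSpace (TotalSpace F V)]
  [∀ x, AddCommGroup (V x)] [∀ x, Module ℝ (V x)] [∀ x, TopologicalSpace (V x)]
  [FiberBundle F V] [VectorBundle ℝ F V] [ContMDiffVectorBundle ∞ F V I]

/-- A coordinate in a local trivialization, cut off by a bump function `ψ`. -/
def bumpCoord (e : Trivialization F (TotalSpace.proj : TotalSpace F V → M))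
    [MemTrivializationAtlas e] (ψ : Fn I M) (h : tsupport ψ ⊆ e.baseSet) (ℓ : F →L[ℝ] ℝ) :
    Sec I F V →ₗ[Fn I M] Fn I M where
  toFun X := ⟨fun x => ψ x * ℓ (e ⟨x, X x⟩).2, by
    refine contMDiff_of_tsupport fun x hx => ?_
    have hx' : x ∈ e.baseSet := h (tsupport_mul_subset_left hx)
    exact (ψ.contMDiff x).mul (ℓ.contMDiff.contMDiffAt.comp x
      ((e.contMDiffAt_section_iff hx').1 (X.contMDiff x)))⟩
  map_add' X Y := by
    ext x
    change ψ x * ℓ (e ⟨x, X x + Y x⟩).2 = ψ x * ℓ (e ⟨x, X x⟩).2 + ψ x * ℓ (e ⟨x, Y x⟩).2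
    by_cases hx : x ∈ e.baseSet
    · rw [(e.linear ℝ hx).map_add, map_add, mul_add]
    · rw [image_eq_zero_of_notMem_tsupport fun h' => hx (h h')]; simp
  map_smul' f X := by
    ext x
    change ψ x * ℓ (e ⟨x, f x • X x⟩).2 = f x * (ψ x * ℓ (e ⟨x, X x⟩).2)
    by_cases hx : x ∈ e.baseSet
    · rw [(e.linear ℝ hx).map_smul, map_smul, smul_eq_mul]; ring
    · rw [image_eq_zero_of_notMem_tsupport fun h' => hx (h h')]; simp

/-- A section of a local frame, cut off by a bump function `ψ`. -/
def bumpFrame (e : Trivialization F (TotalSpace.proj : TotalSpace F V → M))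
    [MemTrivializationAtlas e] (ψ : Fn I M) (h : tsupport ψ ⊆ e.baseSet) {r : ℕ}
    (b : Module.Basis (Fin r) ℝ F) (j : Fin r) : Sec I F V :=
  ⟨(ψ : M → ℝ) • e.localFrame b j, ContMDiffOn.smul_section_of_tsupport ψ.contMDiff.contMDiffOn
    e.open_baseSet h (e.contMDiffOn_localFrame_baseSet ∞ b j)⟩

theorem bumpFrame_apply (e : Trivialization F (TotalSpace.proj : TotalSpace F V → M))
    [MemTrivializationAtlas e] (ψ : Fn I M) (h : tsupport ψ ⊆ e.baseSet) {r : ℕ}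
    (b : Module.Basis (Fin r) ℝ F) (x : M) (v : V x) :
    (ψ x * ψ x) • v = ∑ j, (ψ x * b.coord j (e ⟨x, v⟩).2) • bumpFrame e ψ h b j x := by
  by_cases hx : x ∈ e.baseSet
  · have h1 := (e.basisAt b hx).sum_repr v
    conv_lhs => rw [← h1]
    rw [Finset.smul_sum]
    refine Finset.sum_congr rfl fun j _ => ?_
    change _ = (ψ x * b.coord j (e ⟨x, v⟩).2) • (ψ x • e.localFrame b j x)
    rw [e.localFrame_apply_of_mem_baseSet b hx, smul_smul, smul_smul]
    congr 1
    have : (e.basisAt b hx).repr v j = b.coord j (e ⟨x, v⟩).2 := by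
      simp [Trivialization.basisAt]
    rw [this]; ring
  · rw [image_eq_zero_of_notMem_tsupport fun h' => hx (h h')]; simp

variable (I) in
theorem exists_bump [FiniteDimensional ℝ E] [T2Space M] [IsManifold I ∞ M] (x₀ : M) {U : Set M} (hU : U ∈ 𝓝 x₀) :
    ∃ ψ : Fn I M, ψ x₀ = 1 ∧ tsupport ψ ⊆ U := by
  obtain ⟨f, hf, -⟩ := (SmoothBumpFunction.nhds_basis_support (I := I) hU).mem_iff.1 hU
  exact ⟨⟨f, f.contMDiff⟩, f.eq_one, hf⟩

end Frames

/-- The fibres of a pulled back vector bundle are additive groups. -/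
instance instAddCommGroupPullback {B B' : Type*} (f : B' → B) (V : B → Type*)
    [∀ x, AddCommGroup (V x)] (x : B') : AddCommGroup ((f *ᵖ V) x) :=
  inferInstanceAs (AddCommGroup (V (f x)))

section Hat

variable {E : Type*} [NormedAddCommGroup E] [NormedSpace ℝ E]
  {H : Type*} [TopologicalSpace H] (I : ModelWithCorners ℝ E H)
  {M : Type*} [TopologicalSpace M] [ChartedSpace H M]
  (F : Type*) [NormedAddCommGroup F] [NormedSpace ℝ F]
  (V : M → Type*) [TopologicalSpace (TotalSpace F V)]
  [∀ x, AddCommGroup (V x)] [∀ x, Module ℝ (V x)] [∀ x, TopologicalSpace (V x)]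
  [FiberBundle F V] [VectorBundle ℝ F V]

/-- The projection `M × ℝ → M`. -/
abbrev projM : C^∞⟮I.prod 𝓘(ℝ, ℝ), M × ℝ; I, M⟯ := ContMDiffMap.fst

/-- The module of sections of the bundle `V × ℝ` over `M × ℝ`, i.e. the pullback of `V`
along `M × ℝ → M`. -/
abbrev SecT : Type _ := Sec (I.prod 𝓘(ℝ, ℝ)) F ((projM I : M × ℝ → M) *ᵖ V)

variable {I F V}

/-- Smoothness of sections of the pulled back bundle. -/
theorem contMDiffAt_secT_iff {X : ∀ p : M × ℝ, V p.1} {p₀ : M × ℝ} :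
    ContMDiffAt (I.prod 𝓘(ℝ, ℝ)) ((I.prod 𝓘(ℝ, ℝ)).prod 𝓘(ℝ, F)) ∞
      (fun p => TotalSpace.mk' F (E := (projM I : M × ℝ → M) *ᵖ V) p (X p)) p₀ ↔
    ContMDiffAt (I.prod 𝓘(ℝ, ℝ)) 𝓘(ℝ, F) ∞
      (fun p => (trivializationAt F V p₀.1 ⟨p.1, X p⟩).2) p₀ :=
  contMDiffAt_section p₀

/-- The section `X(·, t)` of `V`. -/
def secSlice (t : ℝ) (X : SecT I F V) : Sec I F V :=
  ⟨fun x => X (x, t), fun x₀ => by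
    have h := contMDiffAt_secT_iff.1 (X.contMDiff (x₀, t))
    refine (contMDiffAt_section (E := V) x₀).2 ?_
    exact ContMDiffAt.comp (f := fun x : M => (x, t)) x₀ h
      (contMDiffAt_id.prodMk contMDiffAt_const)⟩

/-- A section of `V` as a time-independent section. -/
def secConst (X : Sec I F V) : SecT I F V :=
  ⟨fun p => X p.1, fun p₀ => by
    refine contMDiffAt_secT_iff.2 ?_
    have h := (contMDiffAt_section p₀.1).1 (X.contMDiff p₀.1)
    exact ContMDiffAt.comp (f := fun p : M × ℝ => p.1) p₀ h contMDiffAt_fst⟩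

variable (I F V) in
/-- Time-dependent sections of a vector bundle. -/
def secTimeExt [FiniteDimensional ℝ E] [T2Space M] [IsManifold I ∞ M] [FiniteDimensional ℝ F]
    [ContMDiffVectorBundle ∞ F V I] :
    TimeExt I M (Module.finrank ℝ F) (Sec I F V) (SecT I F V) where
  slice t := { toFun := secSlice t, map_zero' := rfl, map_add' := fun _ _ => rfl }
  const := { toFun := secConst, map_zero' := rfl, map_add' := fun _ _ => rfl }
  slice_smul _ _ _ := rfl
  const_smul _ _ := rfl
  slice_const _ _ := rfl
  frame x₀ := by
    set e := trivializationAt F V x₀ with he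
    obtain ⟨ψ, h1, h2⟩ := exists_bump I x₀
      (e.open_baseSet.mem_nhds (mem_baseSet_trivializationAt F V x₀))
    have h3 : tsupport (fnConst ψ) ⊆ (e.pullback (projM I : C^∞⟮I.prod 𝓘(ℝ, ℝ), M × ℝ; I, M⟯)).baseSet := by
      intro p hp
      exact h2 (closure_minimal (t := Prod.fst ⁻¹' (tsupport ψ))
        (fun q hq => subset_closure hq) ((isClosed_tsupport ψ).preimage continuous_fst) hp)
    have : MemTrivializationAtlas
        (e.pullback (projM I : C^∞⟮I.prod 𝓘(ℝ, ℝ), M × ℝ; I, M⟯)) := ⟨⟨e, inferInstance, rfl⟩⟩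
    let b := Module.finBasis ℝ F
    let ℓ (j) : F →L[ℝ] ℝ := LinearMap.toContinuousLinearMap (b.coord j)
    refine ⟨ψ * ψ, bumpFrame e ψ h2 b, fun j => bumpCoord e ψ h2 (ℓ j),
      fun j => bumpCoord (e.pullback (projM I)) (fnConst ψ) h3 (ℓ j), by simp [h1], fun X => ?_,
      fun X => ?_, fun j X t => rfl⟩
    · ext x
      rw [sec_sum_apply]
      exact bumpFrame_apply e ψ h2 b x (X x)
    · ext p
      rw [sec_sum_apply]
      exact bumpFrame_apply e ψ h2 b p.1 (X p)

end Hat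

section HatAlgebroid

variable {E : Type*} [NormedAddCommGroup E] [NormedSpace ℝ E]
  {H : Type*} [TopologicalSpace H] {I : ModelWithCorners ℝ E H}
  {M : Type*} [TopologicalSpace M] [ChartedSpace H M] [IsManifold I ∞ M]

variable (I M) in
/-- Vector fields on `M × ℝ`. -/
abbrev VFT : Type _ := VF (I.prod 𝓘(ℝ, ℝ)) (M × ℝ)

/-- The vector field `Z + g ∂/∂t` on `M × ℝ`. -/
def liftVF (Z : VF I M) (g : Fn I M) : VFT I M :=
  ⟨fun p => ((Z p.1, g p.1) : E × ℝ), by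
    have h1 : ContMDiff (I.prod 𝓘(ℝ, ℝ)) I.tangent ∞
      (fun p : M × ℝ => (⟨p.1, Z p.1⟩ : TangentBundle I M)) := Z.contMDiff.comp contMDiff_fst
    have h2 : ContMDiff (I.prod 𝓘(ℝ, ℝ)) 𝓘(ℝ, ℝ).tangent ∞
      (fun p : M × ℝ => (⟨p.2, g p.1⟩ : TangentBundle 𝓘(ℝ, ℝ) ℝ)) := by
      intro p
      rw [contMDiffAt_totalSpace]
      refine ⟨contMDiffAt_snd, ?_⟩
      have := (g.contMDiff p.1).comp p (contMDiffAt_fst (I := I) (J := 𝓘(ℝ, ℝ)))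
      simpa using! this
    exact contMDiff_equivTangentBundleProd_symm.comp (h1.prodMk h2)⟩

variable (I M) in
/-- The vector field `∂/∂t` on `M × ℝ`. -/
def timeVF : VFT I M := liftVF 0 1

theorem deriv_liftVF_apply {Z : VFT I M} (f : FnT I M) (p : M × ℝ) {Z' : VF I M} {c : ℝ}
    (h : Z p = ((Z' p.1, c) : E × ℝ)) :
    Z.deriv f p = Z'.deriv (fnSlice p.2 f) p.1 + c * (timeVF I M).deriv f p := by
  have hf : MDifferentiableAt (I.prod 𝓘(ℝ, ℝ)) 𝓘(ℝ, ℝ) f p := f.mdifferentiableAt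
  have h1 (v : TangentSpace (I.prod 𝓘(ℝ, ℝ)) p) := mfderiv_prod_eq_add_apply (v := v) hf
  have e1 : Z.deriv f p = _ := h1 (Z p)
  have e2 : (timeVF I M).deriv f p = _ := h1 (timeVF I M p)
  rw [e1, e2, h]
  have h3 : (timeVF I M p) = ((0, 1) : E × ℝ) := rfl
  rw [h3]
  let a : E →L[ℝ] ℝ := mfderiv I 𝓘(ℝ, ℝ) (fun z : M => f (z, p.2)) p.1
  let b : ℝ →L[ℝ] ℝ := mfderiv 𝓘(ℝ, ℝ) 𝓘(ℝ, ℝ) (fun z : ℝ => f (p.1, z)) p.2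
  change a (Z' p.1) + b c = a (Z' p.1) + c * (a 0 + b 1)
  have h5 : b c = c * b 1 := by simpa using map_smul b c 1
  rw [map_zero, zero_add, h5]

theorem hasDerivAt_timeVF (f : FnT I M) (x : M) (t : ℝ) :
    HasDerivAt (fun s => f (x, s)) ((timeVF I M).deriv f (x, t)) t := by
  have hf : MDifferentiableAt (I.prod 𝓘(ℝ, ℝ)) 𝓘(ℝ, ℝ) f (x, t) := f.mdifferentiableAt
  have h1 := mfderiv_prod_eq_add_apply (v := timeVF I M (x, t)) hf
  have h4 : mfderiv I 𝓘(ℝ, ℝ) (fun z : M => f (z, t)) x (0 : E) = 0 := map_zero _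
  have e2 : (timeVF I M).deriv f (x, t) =
      mfderiv 𝓘(ℝ, ℝ) 𝓘(ℝ, ℝ) (fun z : ℝ => f (x, z)) t (1 : ℝ) := by
    refine Eq.trans h1 ?_
    change mfderiv I 𝓘(ℝ, ℝ) (fun z : M => f (z, t)) x (0 : E) + _ = _
    rw [h4]
    exact zero_add _
  have h6 : DifferentiableAt ℝ (fun s => f (x, s)) t := by
    have : ContMDiff 𝓘(ℝ, ℝ) 𝓘(ℝ, ℝ) ∞ (fun s => f (x, s)) :=
      f.contMDiff.comp (contMDiff_const.prodMk contMDiff_id)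
    exact (this.contDiff.differentiable (by simp)) t
  rw [e2, mfderiv_eq_fderiv]
  exact h6.hasDerivAt

variable {r : ℕ} {S T : Type*} [AddCommGroup S] [Module (Fn I M) S]
    [AddCommGroup T] [Module (FnT I M) T]

/-- The anchor `ρ̂(X) = ρ(X) + ⟨φ, X⟩ ∂/∂t`. -/
def hatAnchor (e : TimeExt I M r S T) (ρ : S →ₗ[Fn I M] VF I M) (φ : S →ₗ[Fn I M] Fn I M) :
    T →ₗ[FnT I M] VFT I M where
  toFun X := ⟨fun p => ((ρ (e.slice p.2 X) p.1, φ (e.slice p.2 X) p.1) : E × ℝ), by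
    refine contMDiffSec_of_bump (F := E × ℝ)
      (W := (TangentSpace (I.prod 𝓘(ℝ, ℝ)) : M × ℝ → Type _)) fun x₀ => ?_
    obtain ⟨χ, s, c, c', hχ, -, h', -⟩ := e.frame x₀
    refine ⟨χ, hχ, ∑ j, c' j X • liftVF (ρ (s j)) (φ (s j)), fun p => ?_⟩
    have h0 := e.slice_frame h' p.2 X
    have h1 := congrArg (fun Z : VF I M => (Z p.1 : E)) (congrArg ρ h0)
    have h2 := congrArg (fun f : Fn I M => f p.1) (congrArg φ h0)
    simp only [map_smul, map_sum, sec_sum_apply, fn_sum_apply] at h1 h2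
    rw [sec_sum_apply]
    have e1 : (∑ j, (c' j X • liftVF (ρ (s j)) (φ (s j)) : VFT I M) p : E × ℝ).1 =
        ∑ j, c' j X p • (ρ (s j) p.1 : E) := Prod.fst_sum
    have e2 : (∑ j, (c' j X • liftVF (ρ (s j)) (φ (s j)) : VFT I M) p : E × ℝ).2 =
        ∑ j, c' j X p * φ (s j) p.1 := Prod.snd_sum
    exact Prod.ext (h1.trans e1.symm) (h2.trans e2.symm)⟩
  map_add' X Y := by
    ext p
    refine Prod.ext ?_ ?_
    · change (ρ (e.slice p.2 (X + Y)) p.1 : E) = ρ (e.slice p.2 X) p.1 + ρ (e.slice p.2 Y) p.1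
      rw [map_add, map_add]; rfl
    · change φ (e.slice p.2 (X + Y)) p.1 = φ (e.slice p.2 X) p.1 + φ (e.slice p.2 Y) p.1
      rw [map_add, map_add]; rfl
  map_smul' f X := by
    ext p
    refine Prod.ext ?_ ?_
    · change (ρ (e.slice p.2 (f • X)) p.1 : E) = f p • (ρ (e.slice p.2 X) p.1 : E)
      rw [e.slice_smul, map_smul]; rfl
    · change φ (e.slice p.2 (f • X)) p.1 = f p * φ (e.slice p.2 X) p.1
      rw [e.slice_smul, map_smul]; rfl

theorem hatAnchor_deriv (e : TimeExt I M r S T) (ρ : S →ₗ[Fn I M] VF I M)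
    (φ : S →ₗ[Fn I M] Fn I M) (X : T) (f : FnT I M) (p : M × ℝ) :
    (hatAnchor e ρ φ X).deriv f p = (ρ (e.slice p.2 X)).deriv (fnSlice p.2 f) p.1 +
      φ (e.slice p.2 X) p.1 * (timeVF I M).deriv f p :=
  deriv_liftVF_apply f p rfl

variable [FiniteDimensional ℝ E] [T2Space M]
  {F : Type*} [NormedAddCommGroup F] [NormedSpace ℝ F] [FiniteDimensional ℝ F]
  {V : M → Type*} [TopologicalSpace (TotalSpace F V)]
  [∀ x, AddCommGroup (V x)] [∀ x, Module ℝ (V x)] [∀ x, TopologicalSpace (V x)]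
  [FiberBundle F V] [VectorBundle ℝ F V] [ContMDiffVectorBundle ∞ F V I]

variable (F V) in
/-- The isomorphism of the fibre `V x` with `F`, given by the preferred local trivialization. -/
def fibreEquiv (x : M) : V x ≃ₗ[ℝ] F :=
  (trivializationAt F V x).linearEquivAt (R := ℝ) x (mem_baseSet_trivializationAt F V x)

/-- The value at `(x, t)` of the time derivative of a time-dependent section: the derivative of
the curve `X(x, ·)` in the fibre over `x`. -/
def timeDerivAt (X : SecT I F V) (p : M × ℝ) : ((projM I : M × ℝ → M) *ᵖ V) p :=
  (fibreEquiv F V p.1).symm (deriv (fun s => fibreEquiv F V p.1 (X (p.1, s))) p.2)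

theorem hasDerivAt_fibre (X : SecT I F V) (x : M) (t : ℝ) :
    HasDerivAt (fun s => fibreEquiv F V x (X (x, s)))
      (fibreEquiv F V x (timeDerivAt X (x, t))) t := by
  have h : DifferentiableAt ℝ (fun s => fibreEquiv F V x (X (x, s))) t := by
    have h1 := contMDiffAt_secT_iff.1 (X.contMDiff (x, t))
    have h2 := ContMDiffAt.comp (f := fun s : ℝ => (x, s)) t h1
      (contMDiffAt_const.prodMk contMDiffAt_id)
    exact (h2.contDiffAt.differentiableAt (by simp))
  have := h.hasDerivAt
  rw [timeDerivAt, LinearEquiv.apply_symm_apply]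
  exact this

theorem timeDerivAt_eq (X : SecT I F V) (x : M) (t : ℝ) {v : V x}
    (h : HasDerivAt (fun s => fibreEquiv F V x (X (x, s))) (fibreEquiv F V x v) t) :
    timeDerivAt X (x, t) = v :=
  (fibreEquiv F V x).injective ((hasDerivAt_fibre X x t).unique h)

theorem timeDerivAt_add (X Y : SecT I F V) (p : M × ℝ) :
    timeDerivAt (X + Y) p = timeDerivAt X p + timeDerivAt Y p := by
  refine timeDerivAt_eq _ _ _ ?_
  have := (hasDerivAt_fibre X p.1 p.2).add (hasDerivAt_fibre Y p.1 p.2)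
  refine HasDerivAt.congr_deriv ?_ (map_add (fibreEquiv F V p.1) _ _).symm
  refine this.congr_of_eventuallyEq (Filter.Eventually.of_forall fun s => ?_)
  exact map_add (fibreEquiv F V p.1) _ _

theorem timeDerivAt_smul (f : FnT I M) (X : SecT I F V) (p : M × ℝ) :
    timeDerivAt (f • X) p = f p • timeDerivAt X p + (timeVF I M).deriv f p • X p := by
  refine timeDerivAt_eq _ _ _ ?_
  have := (hasDerivAt_timeVF f p.1 p.2).smul (hasDerivAt_fibre X p.1 p.2)
  have e1 := map_smul (fibreEquiv F V p.1) (f p) (timeDerivAt X p)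
  have e2 := map_smul (fibreEquiv F V p.1) ((timeVF I M).deriv f p) (X p)
  have e3 := (map_add (fibreEquiv F V p.1) (f p • timeDerivAt X p)
    ((timeVF I M).deriv f p • X p)).trans (congrArg₂ (· + ·) e1 e2)
  refine HasDerivAt.congr_deriv ?_ e3.symm
  exact this.congr_of_eventuallyEq
    (Filter.Eventually.of_forall fun s => map_smul (fibreEquiv F V p.1) _ _)

theorem timeDerivAt_const (X : Sec I F V) (p : M × ℝ) : timeDerivAt (secConst X) p = 0 := by
  refine timeDerivAt_eq _ _ _ ?_
  refine HasDerivAt.congr_deriv ?_ (map_zero (fibreEquiv F V p.1)).symm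
  exact hasDerivAt_const p.2 (fibreEquiv F V p.1 (X p.1))

theorem timeDerivAt_sum {ι : Type*} (u : Finset ι) (X : ι → SecT I F V) (p : M × ℝ) :
    timeDerivAt (∑ i ∈ u, X i) p = ∑ i ∈ u, timeDerivAt (X i) p := by
  let D : SecT I F V →+ ((projM I : M × ℝ → M) *ᵖ V) p := AddMonoidHom.mk' (fun X => timeDerivAt X p)
    fun X Y => timeDerivAt_add X Y p
  exact map_sum D X u

/-- The time derivative of a time-dependent section. -/
def timeDeriv (X : SecT I F V) : SecT I F V :=
  ⟨timeDerivAt X, by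
    refine contMDiffSec_of_bump (W := (projM I : M × ℝ → M) *ᵖ V) fun x₀ => ?_
    obtain ⟨χ, s, c, c', hχ, -, h', -⟩ := (secTimeExt I F V).frame x₀
    refine ⟨χ, hχ, ∑ j, (timeVF I M).deriv (c' j X) • secConst (s j), fun p => ?_⟩
    have h1 := congrArg (fun Y => timeDerivAt Y p) (h' X)
    have h2 : (timeVF I M).deriv (fnConst χ) p = 0 :=
      (hasDerivAt_timeVF (fnConst χ) p.1 p.2).unique (hasDerivAt_const p.2 (χ p.1))
    simp only [timeDerivAt_sum, timeDerivAt_smul, h2, zero_smul, add_zero] at h1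
    rw [sec_sum_apply]
    refine Eq.trans h1 (Finset.sum_congr rfl fun j _ => ?_)
    have h3 : timeDerivAt ((secTimeExt I F V).const (s j)) p = 0 := timeDerivAt_const (s j) p
    rw [h3, smul_zero, zero_add]
    rfl⟩

end HatAlgebroid

section HatBracket

variable {E : Type*} [NormedAddCommGroup E] [NormedSpace ℝ E] [FiniteDimensional ℝ E]
  {H : Type*} [TopologicalSpace H] {I : ModelWithCorners ℝ E H}
  {M : Type*} [TopologicalSpace M] [ChartedSpace H M] [IsManifold I ∞ M] [T2Space M]
  {F : Type*} [NormedAddCommGroup F] [NormedSpace ℝ F] [FiniteDimensional ℝ F]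
  {V : M → Type*} [TopologicalSpace (TotalSpace F V)]
  [∀ x, AddCommGroup (V x)] [∀ x, Module ℝ (V x)] [∀ x, TopologicalSpace (V x)]
  [FiberBundle F V] [VectorBundle ℝ F V] [ContMDiffVectorBundle ∞ F V I]

namespace AlmostLieAlgebroid

variable (A : AlmostLieAlgebroid I M (Sec I F V))

theorem bracket_sum {ι : Type*} (u : Finset ι) (X : Sec I F V) (Y : ι → Sec I F V) :
    A.bracket X (∑ i ∈ u, Y i) = ∑ i ∈ u, A.bracket X (Y i) := by
  let D : Sec I F V →+ Sec I F V := AddMonoidHom.mk' (A.bracket X) (A.bracket_add X)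
  exact map_sum D Y u

theorem sum_bracket {ι : Type*} (u : Finset ι) (X : ι → Sec I F V) (Y : Sec I F V) :
    A.bracket (∑ i ∈ u, X i) Y = ∑ i ∈ u, A.bracket (X i) Y := by
  let D : Sec I F V →+ Sec I F V := AddMonoidHom.mk' (A.bracket · Y) fun X X' => A.add_bracket X X' Y
  exact map_sum D X u

/-- The derivative of functions along the horizontal lift of the anchor. -/
theorem horDeriv (X : SecT I F V) (f : FnT I M) (p : M × ℝ) :
    (hatAnchor (secTimeExt I F V) A.anchor 0 X).deriv f p =
      (A.anchor (secSlice p.2 X)).deriv (fnSlice p.2 f) p.1 := by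
  rw [hatAnchor_deriv]
  change _ + 0 * _ = _
  rw [zero_mul, add_zero]
  rfl

theorem contMDiff_sliceBracket_const (X : SecT I F V) (Y : Sec I F V) :
    ContMDiff (I.prod 𝓘(ℝ, ℝ)) ((I.prod 𝓘(ℝ, ℝ)).prod 𝓘(ℝ, F)) ∞
      (fun p => TotalSpace.mk' F (E := (projM I : M × ℝ → M) *ᵖ V) p
        (A.bracket (secSlice p.2 X) Y p.1)) := by
  refine contMDiffSec_of_bump (W := (projM I : M × ℝ → M) *ᵖ V) fun x₀ => ?_
  obtain ⟨χ, s, c, c', hχ, -, h', -⟩ := (secTimeExt I F V).frame x₀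
  refine ⟨χ, hχ, fnConst ((A.anchor Y).deriv χ) • X + ∑ j, (c' j X • secConst (A.bracket (s j) Y)
    - (hatAnchor (secTimeExt I F V) A.anchor 0 (secConst Y)).deriv (c' j X) • secConst (s j)),
    fun p => ?_⟩
  have h0 := (secTimeExt I F V).slice_frame h' p.2 X
  have h1 := congrArg (fun Z => A.bracket Z Y) h0
  simp only [A.smul_bracket, A.sum_bracket] at h1
  have h2 := congrArg (fun Z : Sec I F V => Z p.1) (sub_eq_iff_eq_add'.1 h1)
  refine Eq.trans h2 ?_
  refine congrArg (fun v : V p.1 => (A.anchor Y).deriv χ p.1 • secSlice p.2 X p.1 + v) ?_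
  refine Eq.trans ?_ (sec_sum_apply (Finset.univ) (fun j => c' j X • secConst (A.bracket (s j) Y)
    - (hatAnchor (secTimeExt I F V) A.anchor 0 (secConst Y)).deriv (c' j X) • secConst (s j)) p).symm
  refine Eq.trans (sec_sum_apply _ _ _) (Finset.sum_congr rfl fun j _ => ?_)
  have h3 := A.horDeriv (secConst Y) (c' j X) p
  change _ = c' j X p • (secConst (A.bracket (s j) Y) : SecT I F V) p -
    (hatAnchor (secTimeExt I F V) A.anchor 0 (secConst Y)).deriv (c' j X) p • (secConst (s j) : SecT I F V) p
  rw [h3]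
  rfl

/-- The bracket of two time-dependent sections at fixed times is smooth in space and time. -/
theorem contMDiff_sliceBracket (X Y : SecT I F V) :
    ContMDiff (I.prod 𝓘(ℝ, ℝ)) ((I.prod 𝓘(ℝ, ℝ)).prod 𝓘(ℝ, F)) ∞
      (fun p => TotalSpace.mk' F (E := (projM I : M × ℝ → M) *ᵖ V) p
        (A.bracket (secSlice p.2 X) (secSlice p.2 Y) p.1)) := by
  refine contMDiffSec_of_bump (W := (projM I : M × ℝ → M) *ᵖ V) fun x₀ => ?_
  obtain ⟨χ, s, c, c', hχ, -, h', -⟩ := (secTimeExt I F V).frame x₀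
  let B (j) : SecT I F V := ⟨_, A.contMDiff_sliceBracket_const X (s j)⟩
  refine ⟨χ, hχ, ∑ j, (c' j Y • B j
    + (hatAnchor (secTimeExt I F V) A.anchor 0 X).deriv (c' j Y) • secConst (s j))
    - (hatAnchor (secTimeExt I F V) A.anchor 0 X).deriv (fnConst χ) • Y, fun p => ?_⟩
  have h0 := (secTimeExt I F V).slice_frame h' p.2 Y
  have h1 := congrArg (fun Z => A.bracket (secSlice p.2 X) Z) h0
  simp only [A.bracket_smul, A.bracket_sum] at h1
  have h2 := congrArg (fun Z : Sec I F V => Z p.1) (eq_sub_iff_add_eq.2 h1)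
  refine Eq.trans h2 ?_
  have h3 := A.horDeriv X (fnConst χ) p
  change _ - (A.anchor (secSlice p.2 X)).deriv χ p.1 • Y p =
    (∑ j, (c' j Y • B j + (hatAnchor (secTimeExt I F V) A.anchor 0 X).deriv (c' j Y) •
      secConst (s j)) : SecT I F V) p -
    (hatAnchor (secTimeExt I F V) A.anchor 0 X).deriv (fnConst χ) p • Y p
  rw [h3]
  refine congrArg₂ (· - ·) ?_ rfl
  refine Eq.trans ?_ (sec_sum_apply (Finset.univ) (fun j => c' j Y • B j
    + (hatAnchor (secTimeExt I F V) A.anchor 0 X).deriv (c' j Y) • secConst (s j)) p).symm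
  refine Eq.trans (sec_sum_apply _ _ _) (Finset.sum_congr rfl fun j _ => ?_)
  have h4 := A.horDeriv X (c' j Y) p
  change _ = c' j Y p • B j p +
    (hatAnchor (secTimeExt I F V) A.anchor 0 X).deriv (c' j Y) p • (secConst (s j) : SecT I F V) p
  rw [h4]
  rfl

/-- `(x, t) ↦ [X(·, t), Y(·, t)](x)`. -/
def sliceBracket (X Y : SecT I F V) : SecT I F V := ⟨_, A.contMDiff_sliceBracket X Y⟩

/-- The structure on `Â = A × ℝ` over `M × ℝ` induced by the `1`-form `φ`: the anchor is
`ρ̂(X) = ρ(X) + ⟨φ, X⟩ ∂/∂t`, and the bracket is the one of `A` on time-independent sections. On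
time-dependent sections, the Leibniz rule yields
`[X, Y](·, t) = [X(·, t), Y(·, t)] + ⟨φ, X⟩ ∂Y/∂t - ⟨φ, Y⟩ ∂X/∂t`. -/
def hat (φ : Dual I M (Sec I F V)) :
    AlmostLieAlgebroid (I.prod 𝓘(ℝ, ℝ)) (M × ℝ) (SecT I F V) where
  bracket X Y := A.sliceBracket X Y + (secTimeExt I F V).constDual φ X • timeDeriv Y
    - (secTimeExt I F V).constDual φ Y • timeDeriv X
  anchor := hatAnchor (secTimeExt I F V) A.anchor φ
  bracket_self X := by
    have h : A.sliceBracket X X = 0 := by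
      ext p
      exact congrArg (fun Z : Sec I F V => Z p.1) (A.bracket_self (secSlice p.2 X))
    rw [h]; abel
  bracket_add X Y Z := by
    have h : A.sliceBracket X (Y + Z) = A.sliceBracket X Y + A.sliceBracket X Z := by
      ext p
      exact congrArg (fun Z : Sec I F V => Z p.1) (A.bracket_add (secSlice p.2 X) (secSlice p.2 Y) (secSlice p.2 Z))
    have h2 : timeDeriv (Y + Z) = timeDeriv Y + timeDeriv Z := by
      ext p; exact timeDerivAt_add Y Z p
    rw [h, h2, map_add, smul_add, add_smul]; abel
  add_bracket X Y Z := by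
    have h : A.sliceBracket (X + Y) Z = A.sliceBracket X Z + A.sliceBracket Y Z := by
      ext p
      exact congrArg (fun Z : Sec I F V => Z p.1) (A.add_bracket (secSlice p.2 X) (secSlice p.2 Y) (secSlice p.2 Z))
    have h2 : timeDeriv (X + Y) = timeDeriv X + timeDeriv Y := by
      ext p; exact timeDerivAt_add X Y p
    rw [h, h2, map_add, smul_add, add_smul]; abel
  bracket_smul X f Y := by
    have h : A.sliceBracket X (f • Y) = f • A.sliceBracket X Y +
        (hatAnchor (secTimeExt I F V) A.anchor 0 X).deriv f • Y := by
      ext p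
      have h1 := congrArg (fun Z : Sec I F V => Z p.1)
        (A.bracket_smul (secSlice p.2 X) (fnSlice p.2 f) (secSlice p.2 Y))
      have h2 := A.horDeriv X f p
      change _ = f p • A.sliceBracket X Y p +
        (hatAnchor (secTimeExt I F V) A.anchor 0 X).deriv f p • Y p
      rw [h2]
      exact h1
    have h2 : timeDeriv (f • Y) = f • timeDeriv Y + (timeVF I M).deriv f • Y := by
      ext p; exact timeDerivAt_smul f Y p
    have h3 : (hatAnchor (secTimeExt I F V) A.anchor φ X).deriv f =
        (hatAnchor (secTimeExt I F V) A.anchor 0 X).deriv f +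
        (secTimeExt I F V).constDual φ X * (timeVF I M).deriv f := by
      ext p
      have e1 := hatAnchor_deriv (secTimeExt I F V) A.anchor φ X f p
      have e2 := A.horDeriv X f p
      change _ = (hatAnchor (secTimeExt I F V) A.anchor 0 X).deriv f p + _
      rw [e1, e2]
      rfl
    rw [h, h2, h3, map_smul]
    module

/-- On time-independent sections, the bracket of `Â` is the bracket of `A`. -/
theorem hat_bracket_const (φ : Dual I M (Sec I F V)) (X Y : Sec I F V) :
    (A.hat φ).bracket (secConst X) (secConst Y) = secConst (A.bracket X Y) := by
  have h (Z : Sec I F V) : timeDeriv (secConst Z) = 0 := by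
    ext p; exact timeDerivAt_const Z p
  change A.sliceBracket (secConst X) (secConst Y) + _ • timeDeriv (secConst Y)
    - _ • timeDeriv (secConst X) = _
  rw [h, h, smul_zero, smul_zero, add_zero, sub_zero]
  rfl

end AlmostLieAlgebroid

/-- Freezing the time commutes with the pairing. -/
theorem sliceDual_secSlice (γ : Dual (I.prod 𝓘(ℝ, ℝ)) (M × ℝ) (SecT I F V)) (X : SecT I F V)
    (p : M × ℝ) : γ X p = (secTimeExt I F V).sliceDual p.2 γ (secSlice p.2 X) p.1 := by
  obtain ⟨χ, s, c, c', hχ, -, h', -⟩ := (secTimeExt I F V).frame p.1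
  have h1 := congrArg (fun f : FnT I M => f p) (congrArg γ (h' X))
  have h2 := congrArg (fun f : Fn I M => f p.1) (congrArg
    ((secTimeExt I F V).sliceDual p.2 γ) ((secTimeExt I F V).slice_frame h' p.2 X))
  simp only [map_smul, map_sum, fn_sum_apply] at h1 h2
  exact mul_left_cancel₀ hχ (h1.trans h2.symm)

/-- The map `P^♯` applied to `1`-forms on `Â` at fixed times. -/
def Bivector.constSharp (P : Bivector I M (Sec I F V)) :
    Dual (I.prod 𝓘(ℝ, ℝ)) (M × ℝ) (SecT I F V) →ₗ[FnT I M] SecT I F V where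
  toFun α := ⟨fun p => P.sharp ((secTimeExt I F V).sliceDual p.2 α) p.1, by
    refine contMDiffSec_of_bump (W := (projM I : M × ℝ → M) *ᵖ V) fun x₀ => ?_
    obtain ⟨χ, s, c, c', hχ, -, h', -⟩ := (secTimeExt I F V).dual.frame x₀
    refine ⟨χ, hχ, ∑ j, c' j α • secConst (P.sharp (s j)), fun p => ?_⟩
    have h1 := congrArg (fun Z : Sec I F V => Z p.1)
      (congrArg P.sharp ((secTimeExt I F V).dual.slice_frame h' p.2 α))
    simp only [map_smul, map_sum, sec_sum_apply] at h1 ⊢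
    exact h1⟩
  map_add' α β := by
    ext p
    exact congrArg (fun Z : Sec I F V => Z p.1)
      (map_add P.sharp ((secTimeExt I F V).sliceDual p.2 α) ((secTimeExt I F V).sliceDual p.2 β))
  map_smul' f α := by
    ext p
    exact congrArg (fun Z : Sec I F V => Z p.1)
      (map_smul P.sharp (fnSlice p.2 f) ((secTimeExt I F V).sliceDual p.2 α))

/-- A bivector on `A` as a time-independent bivector on `Â`. -/
def Bivector.const (P : Bivector I M (Sec I F V)) :
    Bivector (I.prod 𝓘(ℝ, ℝ)) (M × ℝ) (SecT I F V) where
  sharp := P.constSharp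
  skew α β := by
    ext p
    have h3 := congrArg (fun f : Fn I M => f p.1)
      (P.skew ((secTimeExt I F V).sliceDual p.2 α) ((secTimeExt I F V).sliceDual p.2 β))
    have h1 := sliceDual_secSlice β (P.constSharp α) p
    have h2 := sliceDual_secSlice α (P.constSharp β) p
    exact (h1.trans h3).trans (congrArg Neg.neg h2.symm)

/-- The horizontal part of a vector field on `M × ℝ`, as a time-dependent vector field on `M`. -/
def horPart : VFT I M →ₗ[FnT I M] SecT I E (TangentSpace I : M → Type _) where
  toFun Z := ⟨fun p => (Z p : E × ℝ).1, fun p₀ => by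
    refine (contMDiffAt_secT_iff (F := E) (V := (TangentSpace I : M → Type _))).2 ?_
    have h1 : ContMDiff (I.prod 𝓘(ℝ, ℝ)) I.tangent ∞
        (fun p : M × ℝ => (⟨p.1, (Z p : E × ℝ).1⟩ : TangentBundle I M)) :=
      contMDiff_fst.comp (contMDiff_equivTangentBundleProd.comp Z.contMDiff)
    exact (contMDiffAt_totalSpace.1 (h1 p₀)).2⟩
  map_add' Z W := by ext p; rfl
  map_smul' f Z := by ext p; rfl

variable (I M) in
/-- The `1`-form `dt` on `M × ℝ`. -/
def timeForm : VFT I M →ₗ[FnT I M] FnT I M where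
  toFun Z := Z.deriv (timeFn I M)
  map_add' Z W := VF.add_deriv Z W _
  map_smul' f Z := VF.smul_deriv f Z _

/-- The form `μ ∧ dt` on `M × ℝ`, for a form `μ` on `M`:
`(μ ∧ dt)(Z₀, …, Zₘ) = (-1)ᵐ ∑ᵢ (-1)ⁱ dt(Zᵢ) μ(Z₀, …, Zᵢ₋₁, Zᵢ₊₁, …, Zₘ)`. -/
def wedgeTime {m : ℕ} (μ : Form I M (VF I M) m) :
    Form (I.prod 𝓘(ℝ, ℝ)) (M × ℝ) (VFT I M) (m + 1) :=
  (-1 : FnT I M) ^ m • AlternatingMap.alternatizeUncurryFin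
    ((timeForm I M).smulRight
      (((secTimeExt I E (TangentSpace I : M → Type _)).constForm μ).compLinearMap horPart))

end HatBracket

section Modular

variable {E : Type*} [NormedAddCommGroup E] [NormedSpace ℝ E] [FiniteDimensional ℝ E]
  {H : Type*} [TopologicalSpace H] {I : ModelWithCorners ℝ E H}
  {M : Type*} [TopologicalSpace M] [ChartedSpace H M] [IsManifold I ∞ M]
  {S : Type*} [AddCommGroup S] [Module (Fn I M) S]

/-- A form vanishes nowhere. -/
def Form.NowhereZero {k : ℕ} (κ : Form I M S k) : Prop :=
  ∀ x : M, ∃ Y : Fin k → S, κ Y x ≠ 0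

/-- A section of `A` as a section of `A**`, i.e. as a `1`-form on `A*`. -/
def toBidual (X : S) : Dual I M (Dual I M S) := LinearMap.applyₗ X

/-- `ξ` is the modular form `ξ_A^{φ, η ⊗ μ} = ξ_A^{η ⊗ μ} - (n - 1) φ` of the Jacobi algebroid
`(A, φ)` of rank `n` with respect to `η ⊗ μ`. -/
def IsJacobiModularForm (A : AlmostLieAlgebroid I M S) (φ : Dual I M S) {n m : ℕ}
    (η : Multivector I M S n) (μ : Form I M (VF I M) m) (ξ : Dual I M S) : Prop :=
  ∃ ξ₀ : Dual I M S, IsModularForm A η μ ξ₀ ∧ ξ = ξ₀ - ((n : Fn I M) - 1) • φ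

variable [T2Space M]
  {F : Type*} [NormedAddCommGroup F] [NormedSpace ℝ F] [FiniteDimensional ℝ F]
  {V : M → Type*} [TopologicalSpace (TotalSpace F V)]
  [∀ x, AddCommGroup (V x)] [∀ x, Module ℝ (V x)] [∀ x, TopologicalSpace (V x)]
  [FiberBundle F V] [VectorBundle ℝ F V] [ContMDiffVectorBundle ∞ F V I]

/-- The structure on the dual of `Â` defined by the bivector `P̃ = e^{-t} P`. -/
def AlmostLieAlgebroid.hatDual (A : AlmostLieAlgebroid I M (Sec I F V))
    (φ : Dual I M (Sec I F V)) (P : Bivector I M (Sec I F V)) :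
    AlmostLieAlgebroid (I.prod 𝓘(ℝ, ℝ)) (M × ℝ)
      (Dual (I.prod 𝓘(ℝ, ℝ)) (M × ℝ) (SecT I F V)) :=
  (A.hat φ).dual 0 (expFn I M (-1) • P.const)

/-- A multivector on `A*` as a time-independent multivector on `Â*`. -/
def constMultivector {k : ℕ} (ν : Multivector I M (Dual I M (Sec I F V)) k) :
    Multivector (I.prod 𝓘(ℝ, ℝ)) (M × ℝ) (Dual (I.prod 𝓘(ℝ, ℝ)) (M × ℝ) (SecT I F V)) k :=
  (secTimeExt I F V).dual.dual.constForm ν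

/-- A `1`-form on `A*` as a time-independent `1`-form on `Â*`. -/
def constBidual (ξ : Dual I M (Dual I M (Sec I F V))) :
    Dual (I.prod 𝓘(ℝ, ℝ)) (M × ℝ) (Dual (I.prod 𝓘(ℝ, ℝ)) (M × ℝ) (SecT I F V)) :=
  (secTimeExt I F V).dual.constDual ξ

end Modular

end LieAlgd

end

/-!
Let `c` be a real number. The anchor and the bracket of `Â*` on time-independent `1`-forms `α`,
`β` of `A` are
`e^{-t} (ρ(P^♯ α) + ⟨X₀, α⟩ ∂/∂t)` and `e^{-t} ([α, β]_P - ⟨X₀, α⟩ β + ⟨X₀, β⟩ α)`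
(`hatDual_anchor`, `hatDual_bracket`), because `⟨φ₀, P^♯ α⟩ = ⟨X₀, α⟩`. The modular form at `α` is
the sum of the factors by which the Lie derivatives rescale `e^{ct} ν` and `μ ∧ dt`. Compared with
`A*`, and up to the common factor `e^{-t}`, the first factor changes by `(c - n + 1) ⟨X₀, α⟩`: the
derivative of `e^{ct}` contributes `c ⟨X₀, α⟩`, and the trace of the correction
`β ↦ -⟨X₀, α⟩ β + ⟨X₀, β⟩ α` to the bracket contributes `(1 - n) ⟨X₀, α⟩`
(`hatDual_lieMultivector`). The second one changes by `-⟨X₀, α⟩`, since the divergence of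
`e^{-t} ∂/∂t` is `-e^{-t}` (`hatDual_lieForm_wedgeTime`).
So `e^t ξ_{Â*} = ξ_{A*} + (c - n) X₀` for the form with respect to `e^{ct} ν ⊗ (μ ∧ dt)`
(`constBidual_modularForm`), and the two identities are the cases `c = n` and `c = 0`.

Existence and uniqueness hold for any skew bracket with an anchor and the Leibniz rule
(`existsUnique_isModularForm`): forms of top degree are pointwise proportional, by expansion in a
local frame, and the derivative terms in the two Lie derivatives along `f X` cancel.
-/

noncomputable section

namespace LieAlgd

set_option linter.unusedSectionVars false

/-! ### Alternating forms of top degree and local frames -/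

section TopForms

variable {R T : Type*} [CommRing R] [AddCommGroup T] [Module R T] {r : ℕ}
  {χ : R} {s : Fin r → T} {c : Fin r → T →ₗ[R] R}

/-- If `T` has rank `r` up to a factor `χ`, forms of degree `r` are multiples of the determinant of
the coordinates. -/
theorem pow_mul_map_eq_det (h : ∀ X, χ • X = ∑ j, c j X • s j) (κ : T [⋀^Fin r]→ₗ[R] R)
    (Y : Fin r → T) : χ ^ r * κ Y = (Matrix.of fun i j => c j (Y i)).det * κ s := by
  have h1 := (κ.compLinearMap (Fintype.linearCombination R s)).eq_smul_basis_det
    (Pi.basisFun R (Fin r))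
  have h2 := congrArg (fun f => f fun i j => c j (Y i)) h1
  have h3 := κ.toMultilinearMap.map_smul_univ (fun _ => χ) Y
  simp only [Finset.prod_const, Finset.card_univ, Fintype.card_fin, smul_eq_mul,
    AlternatingMap.coe_multilinearMap, h] at h3
  rw [← h3]
  refine Eq.trans h2 ?_
  rw [AlternatingMap.smul_apply, Pi.basisFun_det_apply, smul_eq_mul, mul_comm]
  refine congrArg (_ * ·) (congrArg κ (funext fun i => ?_))
  simp

/-- If `T` has rank `r` up to a factor `χ`, then `l ∧ κ` vanishes for a form `κ` of degree `r`; this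
is its expansion, which follows from Cramer's rule. -/
theorem pow_mul_sum_update (h : ∀ X, χ • X = ∑ j, c j X • s j) (κ : T [⋀^Fin r]→ₗ[R] R)
    (l : T →ₗ[R] R) (Z : T) (Y : Fin r → T) :
    χ ^ (r + 1) * ∑ i, l (Y i) * κ (Function.update Y i Z) = χ ^ (r + 1) * (l Z * κ Y) := by
  let C : Matrix (Fin r) (Fin r) R := Matrix.of fun i j => c j (Y i)
  have hl (X : T) : χ * l X = ∑ j, c j X * l (s j) := by
    have := congrArg l (h X)
    simpa using this
  have hu (i : Fin r) : χ ^ r * κ (Function.update Y i Z) =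
      C.transpose.cramer (fun j => c j Z) i * κ s := by
    rw [pow_mul_map_eq_det h, Matrix.cramer_transpose_apply]
    congr 2
    ext a b
    by_cases ha : a = i
    · subst ha; simp
    · simp [ha, C]
  have hC (j : Fin r) : ∑ i, C i j * C.transpose.cramer (fun j => c j Z) i = C.det * c j Z := by
    have := congrFun (Matrix.mulVec_cramer C.transpose fun j => c j Z) j
    rwa [Matrix.det_transpose] at this
  calc χ ^ (r + 1) * ∑ i, l (Y i) * κ (Function.update Y i Z)
      = ∑ i, (χ * l (Y i)) * (χ ^ r * κ (Function.update Y i Z)) := by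
        rw [Finset.mul_sum]; exact Finset.sum_congr rfl fun i _ => by ring
    _ = ∑ j, l (s j) * (∑ i, C i j * C.transpose.cramer (fun j => c j Z) i) * κ s := by
        simp only [hl, hu, Finset.sum_mul, Finset.mul_sum]
        rw [Finset.sum_comm]
        exact Finset.sum_congr rfl fun j _ => Finset.sum_congr rfl fun i _ => by
          change c j (Y i) * _ * _ = l (s j) * (c j (Y i) * _) * _
          ring
    _ = (∑ j, c j Z * l (s j)) * (C.det * κ s) := by
        simp only [hC, Finset.sum_mul]
        exact Finset.sum_congr rfl fun j _ => by ring
    _ = χ ^ (r + 1) * (l Z * κ Y) := by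
        rw [← hl, ← pow_mul_map_eq_det h]; ring

/-- The Lie derivative of an alternating form, for a derivation `D` of the module `T` over the
derivation `δ` of the ring `R`: `Y ↦ δ(κ(Y)) - ∑ᵢ κ(Y₁, …, D Yᵢ, …, Yₖ)`. -/
def leibnizForm {k : ℕ} (δ : R →+ R) (hδ : ∀ f g, δ (f * g) = f * δ g + g * δ f) (D : T →+ T)
    (hD : ∀ (f : R) Y, D (f • Y) = f • D Y + δ f • Y) (κ : T [⋀^Fin k]→ₗ[R] R) :
    T [⋀^Fin k]→ₗ[R] R where
  toFun Y := δ (κ Y) - ∑ i, κ (Function.update Y i (D (Y i)))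
  map_update_add' {inst} Y i a b := by
    obtain rfl : inst = instDecidableEqFin k := Subsingleton.elim _ _
    have h (j : Fin k) : κ (Function.update (Function.update Y i (a + b)) j
          (D (Function.update Y i (a + b) j))) =
        κ (Function.update (Function.update Y i a) j (D (Function.update Y i a j))) +
        κ (Function.update (Function.update Y i b) j (D (Function.update Y i b j))) := by
      by_cases hj : j = i
      · subst hj; simp
      · simp only [Function.update_of_ne hj, Function.update_comm (Ne.symm hj),
          κ.map_update_add]
    simp only [h, κ.map_update_add, map_add, Finset.sum_add_distrib]
    abel
  map_update_smul' {inst} Y i f a := by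
    obtain rfl : inst = instDecidableEqFin k := Subsingleton.elim _ _
    have h (j : Fin k) : κ (Function.update (Function.update Y i (f • a)) j
          (D (Function.update Y i (f • a) j))) =
        f * κ (Function.update (Function.update Y i a) j (D (Function.update Y i a j))) +
        if j = i then δ f * κ (Function.update Y i a) else 0 := by
      by_cases hj : j = i
      · subst hj; simp [hD]
      · simp only [Function.update_of_ne hj, Function.update_comm (Ne.symm hj),
          κ.map_update_smul, if_neg hj, add_zero, smul_eq_mul]
    simp only [h, κ.map_update_smul, Finset.sum_add_distrib, smul_eq_mul, hδ,
      Finset.sum_ite_eq', Finset.mem_univ, if_true, ← Finset.mul_sum]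
    ring
  map_eq_zero_of_eq' Y i j hY hij := by
    rw [κ.map_eq_zero_of_eq _ hY hij, map_zero, zero_sub, neg_eq_zero,
      Finset.sum_eq_add_of_mem i j (Finset.mem_univ _) (Finset.mem_univ _) hij]
    · have h1 : Function.update Y j (D (Y j)) =
          Function.update Y i (D (Y i)) ∘ Equiv.swap i j := by
        ext k
        rcases eq_or_ne k i with rfl | hi
        · simp [hij, hij.symm, hY]
        rcases eq_or_ne k j with rfl | hj
        · simp [hY]
        simp [Equiv.swap_apply_of_ne_of_ne, hi, hj]
      rw [h1, κ.map_swap _ hij, add_neg_cancel]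
    -- the other terms still have two equal arguments
    · rintro k - ⟨hki, hkj⟩
      exact κ.map_eq_zero_of_eq _ (by simp [hki.symm, hkj.symm, hY]) hij

end TopForms

section LocalFrames

variable {E : Type*} [NormedAddCommGroup E] [NormedSpace ℝ E]
  {H : Type*} [TopologicalSpace H] (I : ModelWithCorners ℝ E H)
  (M : Type*) [TopologicalSpace M] [ChartedSpace H M]
  (r : ℕ) (S : Type*) [AddCommGroup S] [Module (Fn I M) S]

/-- The `C^∞(M)`-module `S` has local frames of rank `r`. A frame near `x₀` is given by global sections
`s j` and functionals `c j` which expand `χ X` rather than `X`, for a function `χ` with `χ(x₀) ≠ 0`. -/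
def HasLocalFrames : Prop := ∀ x₀ : M, ∃ (χ : Fn I M) (s : Fin r → S)
  (c : Fin r → S →ₗ[Fn I M] Fn I M), χ x₀ ≠ 0 ∧ ∀ X, χ • X = ∑ j, c j X • s j

variable {I M r S}

theorem TimeExt.hasLocalFrames {T : Type*} [AddCommGroup T] [Module (FnT I M) T]
    (e : TimeExt I M r S T) : HasLocalFrames I M r S := fun x₀ => by
  obtain ⟨χ, s, c, -, hχ, h, -⟩ := e.frame x₀
  exact ⟨χ, s, c, hχ, h⟩

theorem TimeExt.hasLocalFrames_time {T : Type*} [AddCommGroup T] [Module (FnT I M) T]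
    (e : TimeExt I M r S T) : HasLocalFrames (I.prod 𝓘(ℝ, ℝ)) (M × ℝ) r T := fun p₀ => by
  obtain ⟨χ, s, c, c', hχ, -, h, -⟩ := e.frame p₀.1
  exact ⟨fnConst χ, fun j => e.const (s j), c', hχ, h⟩

theorem hasLocalFrames_sec [FiniteDimensional ℝ E] [T2Space M] [IsManifold I ∞ M]
    (F : Type*) [NormedAddCommGroup F] [NormedSpace ℝ F] [FiniteDimensional ℝ F]
    (V : M → Type*) [TopologicalSpace (TotalSpace F V)]
    [∀ x, AddCommGroup (V x)] [∀ x, Module ℝ (V x)] [∀ x, TopologicalSpace (V x)]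
    [FiberBundle F V] [VectorBundle ℝ F V] [ContMDiffVectorBundle ∞ F V I] :
    HasLocalFrames I M (Module.finrank ℝ F) (Sec I F V) :=
  (secTimeExt I F V).hasLocalFrames

theorem fn_pow_apply (f : Fn I M) (k : ℕ) (x : M) : (f ^ k) x = f x ^ k :=
  map_pow (ContMDiffMap.evalRingHom (I := I) (n := ∞) (R := ℝ) (I' := 𝓘(ℝ, ℝ)) x) f k

/-- Forms of top degree are proportional. -/
theorem HasLocalFrames.map_mul_map_comm (hS : HasLocalFrames I M r S) (κ κ' : Form I M S r)
    (Y Y' : Fin r → S) : κ Y * κ' Y' = κ Y' * κ' Y := by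
  ext x
  obtain ⟨χ, s, c, hχ, h⟩ := hS x
  have h1 : χ ^ r * χ ^ r * (κ Y * κ' Y') = χ ^ r * χ ^ r * (κ Y' * κ' Y) := by
    linear_combination (χ ^ r * κ' Y') * pow_mul_map_eq_det h κ Y
      - (χ ^ r * κ' Y) * pow_mul_map_eq_det h κ Y'
      + (Matrix.of fun i j => c j (Y i)).det * κ s * pow_mul_map_eq_det h κ' Y'
      - (Matrix.of fun i j => c j (Y' i)).det * κ s * pow_mul_map_eq_det h κ' Y
  have h2 := congrArg (fun f : Fn I M => f x) h1
  refine mul_left_cancel₀ (a := (χ ^ r * χ ^ r) x) ?_ h2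
  rw [ContMDiffMap.coe_mul, Pi.mul_apply, fn_pow_apply]
  exact mul_ne_zero (pow_ne_zero _ hχ) (pow_ne_zero _ hχ)

/-- The expansion of `l ∧ κ = 0`, for a form `κ` of top degree: the sum is the trace of
`Y ↦ l(Y) Z` acting on `κ`. -/
theorem HasLocalFrames.sum_mul_map_update (hS : HasLocalFrames I M r S) (κ : Form I M S r)
    (l : Dual I M S) (Z : S) (Y : Fin r → S) :
    ∑ i, l (Y i) * κ (Function.update Y i Z) = l Z * κ Y := by
  ext x
  obtain ⟨χ, s, c, hχ, h⟩ := hS x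
  refine mul_left_cancel₀ (a := (χ ^ (r + 1)) x) ?_
    (congrArg (fun f : Fn I M => f x) (pow_mul_sum_update h κ l Z Y))
  rw [fn_pow_apply]
  exact pow_ne_zero _ hχ

/-- A family of linear functionals `N i / D i` whose quotients agree where they are defined glues to
one linear functional, if the denominators do not vanish simultaneously. -/
theorem existsUnique_dual_of_quotients {ι : Type*} (N : ι → Dual I M S) (D : ι → Fn I M)
    (hN : ∀ i j X, N i X * D j = N j X * D i) (hD : ∀ x, ∃ i, D i x ≠ 0) :
    ∃! ξ : Dual I M S, ∀ i X, ξ X * D i = N i X := by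
  choose i hi using hD
  have key (X : S) (x : M) (j : ι) : N (i x) X x / D (i x) x * D j x = N j X x := by
    have := congrArg (fun f : Fn I M => f x) (hN (i x) j X)
    simp only [ContMDiffMap.coe_mul, Pi.mul_apply] at this
    rw [div_mul_eq_mul_div, this, mul_div_assoc, div_self (hi x), mul_one]
  refine ⟨{ toFun := fun X => ⟨fun x => N (i x) X x / D (i x) x, fun x₀ => ?_⟩
            map_add' := fun X Y => ?_
            map_smul' := fun f X => ?_ }, fun j X => ?_, fun ξ hξ => ?_⟩
  · have h1 := ((N (i x₀) X).contMDiff x₀).smul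
      (ContMDiffAt.inv₀ ((D (i x₀)).contMDiff x₀) (hi x₀))
    refine h1.congr_of_eventuallyEq ?_
    filter_upwards [((D (i x₀)).contMDiff x₀).continuousAt.eventually_ne (hi x₀)] with x hx
    change _ = N (i x₀) X x * (D (i x₀) x)⁻¹
    rw [← key X x (i x₀), mul_assoc, mul_inv_cancel₀ hx, mul_one]
  · ext x
    change N (i x) (X + Y) x / _ = N (i x) X x / _ + N (i x) Y x / _
    rw [map_add, ← add_div]
    rfl
  · ext x
    change N (i x) (f • X) x / _ = f x * (N (i x) X x / _)
    rw [map_smul, ← mul_div_assoc]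
    rfl
  · ext x
    exact key X x j
  · ext X x
    have := congrArg (fun f : Fn I M => f x) (hξ (i x) X)
    exact eq_div_of_mul_eq (hi x) this

end LocalFrames

/-! ### Lie derivatives and existence of the modular form -/

section LieDerivatives

variable {E : Type*} [NormedAddCommGroup E] [NormedSpace ℝ E]
  {H : Type*} [TopologicalSpace H] {I : ModelWithCorners ℝ E H}
  {M : Type*} [TopologicalSpace M] [ChartedSpace H M] [IsManifold I ∞ M]
  {S : Type*} [AddCommGroup S] [Module (Fn I M) S]

/-- The derivative along a vector field, as an additive map. -/
def VF.derivHom (Z : VF I M) : Fn I M →+ Fn I M := AddMonoidHom.mk' Z.deriv Z.deriv_add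

/-- The coordinates with respect to a local frame of a module form a local frame of its dual. -/
theorem HasLocalFrames.dual {r : ℕ} (hS : HasLocalFrames I M r S) :
    HasLocalFrames I M r (Dual I M S) := fun x₀ => by
  obtain ⟨χ, s, c, hχ, h⟩ := hS x₀
  refine ⟨χ, c, fun j => LinearMap.applyₗ (s j), hχ, fun α => ?_⟩
  ext X : 1
  rw [LinearMap.smul_apply, ← map_smul, h X, map_sum, LinearMap.sum_apply]
  exact Finset.sum_congr rfl fun j _ => by simp [mul_comm]

namespace AlmostLieAlgebroid

variable (A : AlmostLieAlgebroid I M S)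

theorem lieDual_apply (X : S) (α : Dual I M S) (Y : S) :
    A.lieDual X α Y = (A.anchor X).deriv (α Y) - α (A.bracket X Y) := by
  rw [lieDual, lieTw_apply, LinearMap.zero_apply, zero_mul, add_zero]

theorem lieDual_add (X : S) (α β : Dual I M S) :
    A.lieDual X (α + β) = A.lieDual X α + A.lieDual X β := by
  ext Y : 1
  simp only [lieDual_apply, LinearMap.add_apply, VF.deriv_add]
  ring

theorem lieDual_smul (X : S) (f : Fn I M) (α : Dual I M S) :
    A.lieDual X (f • α) = f • A.lieDual X α + (A.anchor X).deriv f • α := by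
  ext Y : 1
  simp only [lieDual_apply, LinearMap.add_apply, LinearMap.smul_apply, smul_eq_mul, VF.deriv_mul]
  ring

theorem add_lieDual (X X' : S) (α : Dual I M S) :
    A.lieDual (X + X') α = A.lieDual X α + A.lieDual X' α := by
  ext Y : 1
  simp only [lieDual_apply, LinearMap.add_apply, map_add, VF.add_deriv, A.add_bracket]
  ring

theorem smul_lieDual (f : Fn I M) (X : S) (α : Dual I M S) :
    A.lieDual (f • X) α = f • A.lieDual X α + α X • A.d₀ f := by
  ext Y : 1
  simp only [lieDual_apply, LinearMap.add_apply, LinearMap.smul_apply, smul_eq_mul, map_smul,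
    VF.smul_deriv, A.smul_bracket, map_sub, d₀, LinearMap.coe_mk, AddHom.coe_mk]
  ring

/-- The Lie derivative of a `k`-form is a `k`-form. -/
def lieFormMap {k : ℕ} (X : S) (κ : Form I M S k) : Form I M S k :=
  leibnizForm (A.anchor X).derivHom (A.anchor X).deriv_mul
    (AddMonoidHom.mk' (A.bracket X) (A.bracket_add X)) (A.bracket_smul X) κ

theorem lieFormMap_apply {k : ℕ} (X : S) (κ : Form I M S k) (Y : Fin k → S) :
    A.lieFormMap X κ Y = A.lieForm X κ Y := rfl

/-- The Lie derivative of a `k`-vector is a `k`-vector. -/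
def lieMultivectorMap {k : ℕ} (X : S) (η : Multivector I M S k) : Multivector I M S k :=
  leibnizForm (A.anchor X).derivHom (A.anchor X).deriv_mul
    (AddMonoidHom.mk' (A.lieDual X) (A.lieDual_add X)) (A.lieDual_smul X) η

theorem lieMultivectorMap_apply {k : ℕ} (X : S) (η : Multivector I M S k)
    (θ : Fin k → Dual I M S) : A.lieMultivectorMap X η θ = A.lieMultivector X η θ := rfl

theorem add_lieMultivector {k : ℕ} (X X' : S) (η : Multivector I M S k)
    (θ : Fin k → Dual I M S) :
    A.lieMultivector (X + X') η θ = A.lieMultivector X η θ + A.lieMultivector X' η θ := by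
  simp only [lieMultivector, map_add, VF.add_deriv, add_lieDual, η.map_update_add,
    Finset.sum_add_distrib]
  ring

theorem add_lieForm {k : ℕ} (X X' : S) (κ : Form I M S k) (Y : Fin k → S) :
    A.lieForm (X + X') κ Y = A.lieForm X κ Y + A.lieForm X' κ Y := by
  simp only [lieForm, map_add, VF.add_deriv, A.add_bracket, κ.map_update_add,
    Finset.sum_add_distrib]
  ring

/-- `ℒ_{fX} η = f ℒ_X η - ⟨df, X⟩ η` for a multivector of top degree. -/
theorem smul_lieMultivector {n : ℕ} (hS : HasLocalFrames I M n S) (f : Fn I M) (X : S)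
    (η : Multivector I M S n) (θ : Fin n → Dual I M S) :
    A.lieMultivector (f • X) η θ =
      f * A.lieMultivector X η θ - (A.anchor X).deriv f * η θ := by
  have h := hS.dual.sum_mul_map_update η (LinearMap.applyₗ X) (A.d₀ f) θ
  have h' : LinearMap.applyₗ X (A.d₀ f) = (A.anchor X).deriv f := rfl
  simp only [h', LinearMap.applyₗ_apply_apply] at h
  simp only [lieMultivector, map_smul, VF.smul_deriv, smul_lieDual, η.map_update_add,
    η.map_update_smul, Finset.sum_add_distrib, smul_eq_mul, ← Finset.mul_sum, h]
  ring

/-- `ℒ_{fX} κ = f ℒ_X κ + ⟨df, X⟩ κ` for a form of top degree. -/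
theorem smul_lieForm {m : ℕ} (hS : HasLocalFrames I M m S) (f : Fn I M) (X : S)
    (κ : Form I M S m) (Y : Fin m → S) :
    A.lieForm (f • X) κ Y = f * A.lieForm X κ Y + (A.anchor X).deriv f * κ Y := by
  have h := hS.sum_mul_map_update κ (A.d₀ f) X Y
  have h' (Z : S) : A.d₀ f Z = (A.anchor Z).deriv f := rfl
  simp only [h'] at h
  simp only [lieForm, map_smul, VF.smul_deriv, A.smul_bracket, κ.map_update_sub,
    κ.map_update_smul, Finset.sum_sub_distrib, smul_eq_mul, ← Finset.mul_sum, h]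
  ring

end AlmostLieAlgebroid

theorem Form.NowhereZero.exists_mul_ne_zero {T : Type*} [AddCommGroup T] [Module (Fn I M) T]
    {n m : ℕ} {η : Form I M S n} {μ : Form I M T m} (hη : Form.NowhereZero η)
    (hμ : Form.NowhereZero μ) (x : M) :
    ∃ p : (Fin n → S) × (Fin m → T), (η p.1 * μ p.2) x ≠ 0 := by
  obtain ⟨θ, hθ⟩ := hη x
  obtain ⟨Z, hZ⟩ := hμ x
  exact ⟨(θ, Z), mul_ne_zero hθ hZ⟩

/-- The modular form exists and is unique: the value `⟨ξ, X⟩` is the quotient of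
`ℒ_X η ⊗ μ + η ⊗ ℒ_{ρ(X)} μ` by `η ⊗ μ`, both of top degree; it is `C^∞(M)`-linear in `X` because the
derivative terms of the two summands cancel. -/
theorem existsUnique_isModularForm [CompleteSpace E] (A : AlmostLieAlgebroid I M S) {n m : ℕ}
    (hS : HasLocalFrames I M n S) (hV : HasLocalFrames I M m (VF I M))
    {η : Multivector I M S n} (hη : Form.NowhereZero η)
    {μ : Form I M (VF I M) m} (hμ : Form.NowhereZero μ) :
    ∃! ξ, IsModularForm A η μ ξ := by
  let N (p : (Fin n → Dual I M S) × (Fin m → VF I M)) : Dual I M S :=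
    { toFun := fun X => A.lieMultivector X η p.1 * μ p.2 +
        η p.1 * (tangentAlgebroid I M).lieForm (A.anchor X) μ p.2
      map_add' := fun X Y => by
        rw [A.add_lieMultivector, map_add, AlmostLieAlgebroid.add_lieForm]
        ring
      map_smul' := fun f X => by
        rw [A.smul_lieMultivector hS, map_smul, AlmostLieAlgebroid.smul_lieForm _ hV,
          RingHom.id_apply, smul_eq_mul]
        change _ + _ * (_ + (A.anchor X).deriv f * _) = _
        ring }
  obtain ⟨ξ, h1, h2⟩ := existsUnique_dual_of_quotients N (fun p => η p.1 * μ p.2)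
    (fun p q X => by
      have e1 := hS.dual.map_mul_map_comm (A.lieMultivectorMap X η) η p.1 q.1
      have e2 := hV.map_mul_map_comm ((tangentAlgebroid I M).lieFormMap (A.anchor X) μ) μ p.2 q.2
      simp only [AlmostLieAlgebroid.lieMultivectorMap_apply,
        AlmostLieAlgebroid.lieFormMap_apply] at e1 e2
      change (A.lieMultivector X η p.1 * μ p.2 +
          η p.1 * (tangentAlgebroid I M).lieForm (A.anchor X) μ p.2) * (η q.1 * μ q.2) =
          (A.lieMultivector X η q.1 * μ q.2 +
          η q.1 * (tangentAlgebroid I M).lieForm (A.anchor X) μ q.2) * (η p.1 * μ p.2)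
      linear_combination μ p.2 * μ q.2 * e1 + η p.1 * η q.1 * e2)
    fun x => hη.exists_mul_ne_zero hμ x
  exact ⟨ξ, fun X θ Z => h1 (θ, Z) X, fun ξ' h => h2 ξ' fun p X => h X p.1 p.2⟩

end LieDerivatives

/-! ### The Lie bracket of vector fields as a commutator -/

section LieBracket

variable {E : Type*} [NormedAddCommGroup E] [NormedSpace ℝ E]
  {H : Type*} [TopologicalSpace H] {I : ModelWithCorners ℝ E H}
  {M : Type*} [TopologicalSpace M] [ChartedSpace H M] [IsManifold I ∞ M]

/-- The derivative along a vector field in a chart. -/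
theorem fderivWithin_comp_extChartAt_symm (W : VF I M) (f : Fn I M) (x₀ : M) {u : E}
    (hu : u ∈ (extChartAt I x₀).target) :
    fderivWithin ℝ (f ∘ (extChartAt I x₀).symm) (Set.range I) u
      (VectorField.mpullbackWithin 𝓘(ℝ, E) I (extChartAt I x₀).symm W (Set.range I) u) =
    W.deriv f ((extChartAt I x₀).symm u) := by
  have hs := isInvertible_mfderivWithin_extChartAt_symm (I := I) hu
  have h1 := mfderivWithin_comp (I := 𝓘(ℝ, E)) (I' := I) (I'' := 𝓘(ℝ, ℝ)) (g := f)
    (f := (extChartAt I x₀).symm) (s := Set.range I) (u := Set.univ) u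
    f.mdifferentiableAt.mdifferentiableWithinAt
    (mdifferentiableWithinAt_extChartAt_symm hu) (Set.subset_univ _)
    (I.uniqueMDiffOn _ (extChartAt_target_subset_range x₀ hu))
  rw [mfderivWithin_eq_fderivWithin] at h1
  rw [h1, mfderivWithin_univ, VectorField.mpullbackWithin_apply]
  change mfderiv I 𝓘(ℝ, ℝ) f ((extChartAt I x₀).symm u) _ = mfderiv I 𝓘(ℝ, ℝ) f _ _
  refine congrArg _ ?_
  exact hs.self_apply_inverse _

/-- At the centre of the chart, the derivative of the chart is the identity of the tangent space. -/
theorem fderivWithin_comp_extChartAt_symm_self (f : Fn I M) (x₀ : M) (v : E) :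
    fderivWithin ℝ (f ∘ (extChartAt I x₀).symm) (Set.range I) (extChartAt I x₀ x₀) v =
      mvfderiv I f x₀ v := by
  have hu := mem_extChartAt_target (I := I) x₀
  have h1 := mfderivWithin_comp (I := 𝓘(ℝ, E)) (I' := I) (I'' := 𝓘(ℝ, ℝ)) (g := f)
    (f := (extChartAt I x₀).symm) (s := Set.range I) (u := Set.univ) _
    f.mdifferentiableAt.mdifferentiableWithinAt
    (mdifferentiableWithinAt_extChartAt_symm hu) (Set.subset_univ _)
    (I.uniqueMDiffOn _ (extChartAt_target_subset_range x₀ hu))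
  rw [mfderivWithin_eq_fderivWithin, mfderivWithin_range_extChartAt_symm, mfderivWithin_univ] at h1
  rw [h1]
  have h2 : (extChartAt I x₀).symm (extChartAt I x₀ x₀) = x₀ := extChartAt_to_inv x₀
  change (mfderiv I 𝓘(ℝ, ℝ) f ((extChartAt I x₀).symm (extChartAt I x₀ x₀)) : E →L[ℝ] ℝ) v =
    (mfderiv I 𝓘(ℝ, ℝ) f x₀ : E →L[ℝ] ℝ) v
  rw [h2]

/-- The Lie bracket acts on functions as the commutator: in a chart, this is the symmetry of the
second derivative. -/
theorem VF.lie_deriv [CompleteSpace E] (Z W : VF I M) (f : Fn I M) :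
    (Z.lie W).deriv f = Z.deriv (W.deriv f) - W.deriv (Z.deriv f) := by
  ext x
  set φ := extChartAt I x with hφ
  let pull (Z : VF I M) : E → E :=
    VectorField.mpullbackWithin 𝓘(ℝ, E) I φ.symm Z (Set.range I)
  have hd (Z : VF I M) : DifferentiableWithinAt ℝ (pull Z) (Set.range I) (φ x) := by
    have := MDifferentiableWithinAt.differentiableWithinAt_mpullbackWithin_vectorField
      (Z.mdifferentiableAt (x := x)).mdifferentiableWithinAt (s := Set.univ)
    rwa [Set.preimage_univ, Set.univ_inter] at this
  have hpull (Z : VF I M) : pull Z (φ x) = (Z x : E) := by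
    have h1 : (Z (φ.symm (φ x)) : E) = Z x :=
      congrArg (fun y => (Z y : E)) (extChartAt_to_inv (I := I) x)
    exact (mfderivWithin_extChartAt_symm_inverse_apply (I := I) (x := x) _).trans h1
  have hev (W : VF I M) : (fun u => fderivWithin ℝ (f ∘ φ.symm) (Set.range I) u (pull W u))
      =ᶠ[𝓝[Set.range I] (φ x)] (W.deriv f ∘ φ.symm) :=
    Filter.eventuallyEq_of_mem (extChartAt_target_mem_nhdsWithin x)
      fun u hu => fderivWithin_comp_extChartAt_symm W f x hu
  have hf : ContDiffWithinAt ℝ ∞ (f ∘ φ.symm) (Set.range I) (φ x) :=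
    (f.contMDiff.contMDiffAt.comp_contMDiffWithinAt _ (contMDiffWithinAt_extChartAt_symm_range x
      (mem_extChartAt_target x))).contDiffWithinAt
  have h := VectorField.fderivWithin_apply_lieBracket hf (n := ∞) (V := pull Z) (W := pull W)
    (by rw [minSmoothness_of_isRCLikeNormedField]; exact WithTop.coe_le_coe.2 le_top) I.uniqueDiffOn
    (I.range_subset_closure_interior (Set.mem_range_self _)) (Set.mem_range_self _) (hd W) (hd Z)
  have hx : (φ x : E) ∈ Set.range I := Set.mem_range_self _
  rw [(hev W).fderivWithin_eq_of_mem hx, (hev Z).fderivWithin_eq_of_mem hx, hpull, hpull] at h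
  replace h := (fderivWithin_comp_extChartAt_symm_self f x _).symm.trans (h.trans (congrArg₂ (· - ·)
    (fderivWithin_comp_extChartAt_symm_self (W.deriv f) x _)
    (fderivWithin_comp_extChartAt_symm_self (Z.deriv f) x _)))
  refine Eq.trans ?_ h
  change mvfderiv I f x (VectorField.mlieBracket I Z W x) = _
  refine congrArg _ ?_
  have h1 (L : E →L[ℝ] E) (hL : L = ContinuousLinearMap.id ℝ E) (v : E) : L.inverse v = v := by
    rw [hL, ContinuousLinearMap.inverse_id]; rfl
  refine (h1 _ (mfderiv_extChartAt_self (I := I)) _).trans ?_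
  rw [Set.preimage_univ, Set.univ_inter]

/-- Tangent vectors which agree as derivations of the smooth functions on `M` are equal. -/
theorem tangent_ext [FiniteDimensional ℝ E] [T2Space M] {x : M} {v w : TangentSpace I x}
    (h : ∀ f : Fn I M, mvfderiv I f x v = mvfderiv I f x w) : v = w := by
  -- the functions used are linear functionals of the chart, cut off near `x`
  obtain ⟨ψ⟩ : Nonempty (SmoothBumpFunction I x) := inferInstance
  refine SeparatingDual.eq_iff_forall_dual_eq (R := ℝ) (V := E) |>.2 fun l => ?_
  have hg : ContMDiffOn I 𝓘(ℝ, ℝ) ∞ (fun y => l (extChartAt I x y)) (chartAt H x).source :=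
    l.contMDiff.comp_contMDiffOn contMDiffOn_extChartAt
  let f : Fn I M := ⟨fun y => ψ y • l (extChartAt I x y), ψ.contMDiff_smul hg⟩
  have h1 : (f : M → ℝ) =ᶠ[𝓝 x] l ∘ extChartAt I x := by
    filter_upwards [ψ.eventuallyEq_one] with y hy
    change ψ y • l (extChartAt I x y) = _
    rw [hy]; simp
  have h2 : HasMFDerivAt I 𝓘(ℝ, ℝ) (l ∘ extChartAt I x) x
      (l ∘L (ContinuousLinearMap.id ℝ E)) := by
    have := (mdifferentiableAt_extChartAt (I := I) (mem_chart_source H x)).hasMFDerivAt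
    rw [mfderiv_extChartAt_self] at this
    exact l.hasMFDerivAt.comp x this
  have h3 := (h2.congr_of_eventuallyEq h1).mfderiv
  have h4 (u : TangentSpace I x) : mvfderiv I f x u = l u := by
    change (mfderiv I 𝓘(ℝ, ℝ) f x : E →L[ℝ] ℝ) u = _
    rw [h3]
    rfl
  have h5 := h f
  rw [h4, h4] at h5
  exact h5

end LieBracket

/-! ### Time-independent objects on the product with the line -/

section TimeDependent

variable {E : Type*} [NormedAddCommGroup E] [NormedSpace ℝ E]
  {H : Type*} [TopologicalSpace H] {I : ModelWithCorners ℝ E H}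
  {M : Type*} [TopologicalSpace M] [ChartedSpace H M]

theorem fnConst_add (f g : Fn I M) : fnConst (f + g) = fnConst f + fnConst g := rfl
theorem fnConst_sub (f g : Fn I M) : fnConst (f - g) = fnConst f - fnConst g := rfl
theorem fnConst_mul (f g : Fn I M) : fnConst (f * g) = fnConst f * fnConst g := rfl
theorem fnConst_one : fnConst (1 : Fn I M) = 1 := rfl

theorem fnConst_sum {ι : Type*} (u : Finset ι) (f : ι → Fn I M) :
    fnConst (∑ i ∈ u, f i) = ∑ i ∈ u, fnConst (f i) :=
  map_sum (AddMonoidHom.mk' (fnConst (I := I) (M := M)) fnConst_add) f u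

theorem expFn_mul_expFn (a b : ℝ) : expFn I M a * expFn I M b = expFn I M (a + b) := by
  ext p
  change Real.exp (a * p.2) * Real.exp (b * p.2) = Real.exp ((a + b) * p.2)
  rw [← Real.exp_add, add_mul]

theorem expFn_zero : expFn I M 0 = 1 := by
  ext p
  change Real.exp (0 * p.2) = 1
  rw [zero_mul, Real.exp_zero]

/-- A time-dependent form is determined by its values on time-independent sections. -/
theorem TimeExt.dual_ext {r : ℕ} {S T : Type*} [AddCommGroup S] [Module (Fn I M) S]
    [AddCommGroup T] [Module (FnT I M) T] (e : TimeExt I M r S T) {γ γ' : T →ₗ[FnT I M] FnT I M}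
    (h : ∀ X, γ (e.const X) = γ' (e.const X)) : γ = γ' := by
  ext Y p
  obtain ⟨χ, s, c, c', hχ, -, h', -⟩ := e.frame p.1
  have h1 : fnConst χ • γ Y = fnConst χ • γ' Y := by
    simp only [← map_smul, h', map_sum]
    simp only [map_smul, h]
  exact mul_left_cancel₀ hχ (congrArg (fun f : FnT I M => f p) h1)

theorem TimeExt.constDual_const {r : ℕ} {S T : Type*} [AddCommGroup S] [Module (Fn I M) S]
    [AddCommGroup T] [Module (FnT I M) T] (e : TimeExt I M r S T) (α : S →ₗ[Fn I M] Fn I M)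
    (X : S) : e.constDual α (e.const X) = fnConst (α X) := by
  ext p
  change α (e.slice p.2 (e.const X)) p.1 = α X p.1
  rw [e.slice_const]

theorem TimeExt.constForm_const {r k : ℕ} {S T : Type*} [AddCommGroup S] [Module (Fn I M) S]
    [AddCommGroup T] [Module (FnT I M) T] (e : TimeExt I M r S T)
    (κ : S [⋀^Fin k]→ₗ[Fn I M] Fn I M) (X : Fin k → S) :
    e.constForm κ (fun i => e.const (X i)) = fnConst (κ X) := by
  ext p
  change κ (fun i => e.slice p.2 (e.const (X i))) p.1 = κ X p.1
  simp only [e.slice_const]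

theorem TimeExt.constForm_update_smul {r k : ℕ} {S T : Type*} [AddCommGroup S]
    [Module (Fn I M) S] [AddCommGroup T] [Module (FnT I M) T] (e : TimeExt I M r S T)
    (κ : S [⋀^Fin k]→ₗ[Fn I M] Fn I M) (X : Fin k → S) (i : Fin k) (f : FnT I M) (Y : S) :
    e.constForm κ (Function.update (fun j => e.const (X j)) i (f • e.const Y)) =
      f * fnConst (κ (Function.update X i Y)) := by
  have h : Function.update (fun j => e.const (X j)) i (e.const Y) =
      fun j => e.const (Function.update X i Y j) := by
    ext j
    by_cases hj : j = i
    · subst hj; simp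
    · simp [hj]
  rw [AlternatingMap.map_update_smul, h, e.constForm_const, smul_eq_mul]

variable [IsManifold I ∞ M]

theorem liftVF_deriv_fnConst (Z : VF I M) (g f : Fn I M) :
    (liftVF Z g).deriv (fnConst f) = fnConst (Z.deriv f) := by
  ext p
  have h : (timeVF I M).deriv (fnConst f) p = 0 :=
    (hasDerivAt_timeVF (fnConst f) p.1 p.2).unique (hasDerivAt_const p.2 (f p.1))
  rw [deriv_liftVF_apply (Z' := Z) (c := g p.1) (fnConst f) p rfl, h, mul_zero, add_zero]
  rfl

theorem VF.deriv_const (Z : VF I M) (c : ℝ) : Z.deriv ⟨fun _ => c, contMDiff_const⟩ = 0 := by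
  ext x
  have h : mvfderiv I (fun _ : M => c) x = 0 := mvfderiv_const c
  change mvfderiv I (fun _ : M => c) x (Z x) = 0
  rw [h]
  rfl

theorem liftVF_deriv_expFn (Z : VF I M) (g : Fn I M) (c : ℝ) :
    (liftVF Z g).deriv (expFn I M c) = c • (fnConst g * expFn I M c) := by
  ext p
  have h1 : HasDerivAt (fun s => Real.exp (c * s)) (Real.exp (c * p.2) * (c * 1)) p.2 :=
    ((hasDerivAt_id p.2).const_mul c).exp
  have h : (timeVF I M).deriv (expFn I M c) p = c * Real.exp (c * p.2) :=
    (hasDerivAt_timeVF (expFn I M c) p.1 p.2).unique (h1.congr_deriv (by rw [mul_one, mul_comm]))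
  have h2 : Z.deriv (fnSlice p.2 (expFn I M c)) = 0 := VF.deriv_const Z (Real.exp (c * p.2))
  rw [deriv_liftVF_apply (Z' := Z) (c := g p.1) _ p rfl, h, h2]
  change 0 + g p.1 * (c * Real.exp (c * p.2)) = c * (g p.1 * Real.exp (c * p.2))
  ring

theorem liftVF_deriv_timeFn (Z : VF I M) (g : Fn I M) :
    (liftVF Z g).deriv (timeFn I M) = fnConst g := by
  ext p
  have h : (timeVF I M).deriv (timeFn I M) p = 1 :=
    (hasDerivAt_timeVF (timeFn I M) p.1 p.2).unique (hasDerivAt_id p.2)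
  have h2 : Z.deriv (fnSlice p.2 (timeFn I M)) = 0 := VF.deriv_const Z _
  rw [deriv_liftVF_apply (Z' := Z) (c := g p.1) _ p rfl, h, h2]
  change 0 + g p.1 * 1 = g p.1
  ring

theorem timeForm_liftVF (Z : VF I M) (g : Fn I M) : timeForm I M (liftVF Z g) = fnConst g :=
  liftVF_deriv_timeFn Z g

variable [FiniteDimensional ℝ E] [T2Space M]

theorem horPart_liftVF (Z : VF I M) (g : Fn I M) : horPart (liftVF Z g) = secConst Z := rfl

/-- The horizontal part of the Lie bracket of lifts from `M` is the Lie bracket on `M`. -/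
theorem horPart_lie_liftVF (Z W : VF I M) (g h : Fn I M) :
    horPart ((liftVF Z g).lie (liftVF W h)) = secConst (Z.lie W) := by
  ext p
  -- compare the action on time-independent functions
  refine tangent_ext (I := I) (x := p.1) fun f => ?_
  set B := (liftVF Z g).lie (liftVF W h)
  have h1 : B.deriv (fnConst f) = fnConst ((Z.lie W).deriv f) := by
    simp only [B, VF.lie_deriv, liftVF_deriv_fnConst, fnConst_sub]
  have h2 := deriv_liftVF_apply (Z := B) (Z' := secSlice p.2 (horPart B)) (c := (B p : E × ℝ).2)
    (fnConst f) p rfl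
  have h3 : (timeVF I M).deriv (fnConst f) p = 0 :=
    (hasDerivAt_timeVF (fnConst f) p.1 p.2).unique (hasDerivAt_const p.2 (f p.1))
  rw [h1, h3, mul_zero, add_zero] at h2
  exact h2.symm

/-- The lift `Z + g ∂/∂t` commutes with `∂/∂t`, as its coefficients are time-independent; this is
the vertical part of that fact. -/
theorem timeForm_lie_liftVF_timeVF (Z : VF I M) (g : Fn I M) :
    timeForm I M ((liftVF Z g).lie (timeVF I M)) = 0 := by
  change ((liftVF Z g).lie (timeVF I M)).deriv (timeFn I M) = 0
  have h1 : Z.deriv 1 = 0 := VF.deriv_const Z 1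
  have h2 : (0 : VF I M).deriv g = 0 := by ext x; exact map_zero (mvfderiv I g x)
  rw [VF.lie_deriv, liftVF_deriv_timeFn, timeVF, liftVF_deriv_timeFn, liftVF_deriv_fnConst,
    liftVF_deriv_fnConst, h1, h2, sub_self]

theorem hasLocalFrames_vf : HasLocalFrames I M (Module.finrank ℝ E) (VF I M) :=
  hasLocalFrames_sec E (TangentSpace I : M → Type _)

theorem hasLocalFrames_vf_time :
    HasLocalFrames (I.prod 𝓘(ℝ, ℝ)) (M × ℝ) (Module.finrank ℝ E + 1) (VFT I M) := by
  have h : Module.finrank ℝ (E × ℝ) = Module.finrank ℝ E + 1 := by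
    rw [Module.finrank_prod, Module.finrank_self]
  exact h ▸ hasLocalFrames_vf

/-- In `(μ ∧ dt)(Y₁, …, Yₘ, B)` only the term `dt(B) μ(Y₁, …, Yₘ)` survives if the `Yᵢ` are
horizontal or `B` is vertical. -/
theorem wedgeTime_snoc {m : ℕ} (μ : Form I M (VF I M) m) (Y : Fin m → VFT I M) (B : VFT I M)
    (h : (∀ i, timeForm I M (Y i) = 0) ∨ horPart B = 0) :
    wedgeTime μ (Fin.snoc (α := fun _ => VFT I M) Y B) = timeForm I M B *
      (secTimeExt I E (TangentSpace I : M → Type _)).constForm μ (fun i => horPart (Y i)) := by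
  rw [wedgeTime, AlternatingMap.smul_apply, AlternatingMap.alternatizeUncurryFin_apply,
    Fin.sum_univ_castSucc, Finset.sum_eq_zero, zero_add]
  · have h1 : (-1 : FnT I M) ^ m * (-1) ^ m = 1 := by rw [← mul_pow]; simp
    simp only [Fin.val_last, Fin.snoc_last, Fin.removeNth_last, Fin.init_snoc,
      LinearMap.smulRight_apply, AlternatingMap.smul_apply, smul_eq_mul, zsmul_eq_mul]
    push_cast
    rw [← mul_assoc, h1, one_mul]
    rfl
  · intro i _
    refine smul_eq_zero_of_right _ ?_
    rw [LinearMap.smulRight_apply, Fin.snoc_castSucc]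
    rcases h with h | h
    · rw [h, zero_smul]; rfl
    -- `B` is still one of the arguments of `μ`
    · obtain ⟨j, hj⟩ := Fin.exists_succAbove_eq (Fin.castSucc_lt_last i).ne'
      rw [AlternatingMap.smul_apply, AlternatingMap.compLinearMap_apply,
        AlternatingMap.map_coord_zero _ j, smul_zero]
      change horPart (Fin.snoc (α := fun _ => VFT I M) Y B (i.castSucc.succAbove j)) = 0
      rw [hj, Fin.snoc_last, h]

/-- The lifts of vector fields on `M` to `M × ℝ`, followed by `∂/∂t`. -/
def liftFrame {m : ℕ} (Z : Fin m → VF I M) : Fin (m + 1) → VFT I M :=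
  Fin.snoc (α := fun _ => VFT I M) (fun i => liftVF (Z i) 0) (timeVF I M)

theorem wedgeTime_snoc_timeVF {m : ℕ} (μ : Form I M (VF I M) m) (Y : Fin m → VFT I M)
    (Z : Fin m → VF I M) (h : ∀ i, horPart (Y i) = secConst (Z i)) :
    wedgeTime μ (Fin.snoc (α := fun _ => VFT I M) Y (timeVF I M)) = fnConst (μ Z) := by
  rw [wedgeTime_snoc μ Y _ (Or.inr rfl), timeVF, timeForm_liftVF, fnConst_one, one_mul]
  simp only [h]
  exact (secTimeExt I E (TangentSpace I : M → Type _)).constForm_const μ Z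

theorem wedgeTime_liftFrame {m : ℕ} (μ : Form I M (VF I M) m) (Z : Fin m → VF I M) :
    wedgeTime μ (liftFrame Z) = fnConst (μ Z) :=
  wedgeTime_snoc_timeVF μ _ Z fun i => horPart_liftVF (Z i) 0

theorem wedgeTime_nowhereZero {m : ℕ} {μ : Form I M (VF I M) m} (hμ : Form.NowhereZero μ) :
    Form.NowhereZero (wedgeTime μ) := fun p => by
  obtain ⟨Z, hZ⟩ := hμ p.1
  exact ⟨liftFrame Z, by rw [wedgeTime_liftFrame]; exact hZ⟩

/-- `ℒ_{W + g ∂/∂t} (μ ∧ dt) = ℒ_W μ ∧ dt` for a time-independent function `g`. -/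
theorem lieForm_liftVF_wedgeTime {m : ℕ} (μ : Form I M (VF I M) m) (W : VF I M) (g : Fn I M)
    (Z : Fin m → VF I M) :
    (tangentAlgebroid (I.prod 𝓘(ℝ, ℝ)) (M × ℝ)).lieForm (liftVF W g) (wedgeTime μ) (liftFrame Z) =
      fnConst ((tangentAlgebroid I M).lieForm W μ Z) := by
  change (liftVF W g).deriv (wedgeTime μ (liftFrame Z)) - ∑ i, wedgeTime μ
    (Function.update (liftFrame Z) i ((liftVF W g).lie (liftFrame Z i))) =
    fnConst (W.deriv (μ Z) - ∑ i, μ (Function.update Z i (W.lie (Z i))))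
  rw [wedgeTime_liftFrame, liftVF_deriv_fnConst, fnConst_sub, fnConst_sum,
    Fin.sum_univ_castSucc]
  have h1 : wedgeTime μ (Function.update (liftFrame Z) (Fin.last m)
      ((liftVF W g).lie (liftFrame Z (Fin.last m)))) = 0 := by
    rw [liftFrame, Fin.snoc_last, Fin.update_snoc_last,
      wedgeTime_snoc _ _ _ (Or.inl fun i => timeForm_liftVF (Z i) 0),
      timeForm_lie_liftVF_timeVF, zero_mul]
  rw [h1, add_zero]
  refine congrArg (_ - ·) (Finset.sum_congr rfl fun i _ => ?_)
  rw [liftFrame, Fin.snoc_castSucc, ← Fin.snoc_update]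
  refine wedgeTime_snoc_timeVF μ _ _ fun j => ?_
  by_cases hj : j = i
  · subst hj
    rw [Function.update_self, Function.update_self, horPart_lie_liftVF]
  · rw [Function.update_of_ne hj, Function.update_of_ne hj, horPart_liftVF]

end TimeDependent

/-! ### The Lie algebroid structure on the dual of `Â` -/

section HatDual

variable {E : Type*} [NormedAddCommGroup E] [NormedSpace ℝ E] [FiniteDimensional ℝ E]
  {H : Type*} [TopologicalSpace H] {I : ModelWithCorners ℝ E H}
  {M : Type*} [TopologicalSpace M] [ChartedSpace H M] [IsManifold I ∞ M] [T2Space M]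
  {F : Type*} [NormedAddCommGroup F] [NormedSpace ℝ F] [FiniteDimensional ℝ F]
  {V : M → Type*} [TopologicalSpace (TotalSpace F V)]
  [∀ x, AddCommGroup (V x)] [∀ x, Module ℝ (V x)] [∀ x, TopologicalSpace (V x)]
  [FiberBundle F V] [VectorBundle ℝ F V] [ContMDiffVectorBundle ∞ F V I]

/-- A `1`-form on `A` as a time-independent `1`-form on `Â`. -/
def formConst (α : Dual I M (Sec I F V)) : Dual (I.prod 𝓘(ℝ, ℝ)) (M × ℝ) (SecT I F V) :=
  (secTimeExt I F V).constDual α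

theorem formConst_secConst (α : Dual I M (Sec I F V)) (X : Sec I F V) :
    formConst α (secConst X) = fnConst (α X) :=
  (secTimeExt I F V).constDual_const α X

theorem constBidual_formConst (θ : Dual I M (Dual I M (Sec I F V))) (α : Dual I M (Sec I F V)) :
    constBidual θ (formConst α) = fnConst (θ α) :=
  (secTimeExt I F V).dual.constDual_const θ α

theorem constBidual_sub (θ θ' : Dual I M (Dual I M (Sec I F V))) :
    constBidual (θ - θ') = constBidual θ - constBidual θ' := rfl

theorem constBidual_smul (c : ℝ) (θ : Dual I M (Dual I M (Sec I F V))) :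
    constBidual (c • θ) = c • constBidual θ := rfl

theorem constMultivector_constBidual {k : ℕ} (ν : Multivector I M (Dual I M (Sec I F V)) k)
    (θ : Fin k → Dual I M (Dual I M (Sec I F V))) :
    constMultivector ν (fun i => constBidual (θ i)) = fnConst (ν θ) :=
  (secTimeExt I F V).dual.dual.constForm_const ν θ

theorem exp_smul_constMultivector_nowhereZero {k : ℕ} (c : ℝ)
    {ν : Multivector I M (Dual I M (Sec I F V)) k} (hν : Form.NowhereZero ν) :
    Form.NowhereZero (expFn I M c • constMultivector ν) := fun p => by
  obtain ⟨θ, hθ⟩ := hν p.1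
  refine ⟨fun i => constBidual (θ i), ?_⟩
  rw [AlternatingMap.smul_apply, constMultivector_constBidual]
  exact mul_ne_zero (Real.exp_ne_zero _) hθ

theorem Bivector.const_sharp (P : Bivector I M (Sec I F V)) (α : Dual I M (Sec I F V)) :
    P.const.sharp (formConst α) = secConst (P.sharp α) := by
  ext p
  exact congrArg (fun β => P.sharp β p.1) ((secTimeExt I F V).dual.slice_const p.2 α)

namespace AlmostLieAlgebroid

variable (A : AlmostLieAlgebroid I M (Sec I F V)) (φ : Dual I M (Sec I F V))
  (P : Bivector I M (Sec I F V))

theorem hat_anchor_secConst (X : Sec I F V) :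
    (A.hat φ).anchor (secConst X) = liftVF (A.anchor X) (φ X) := rfl

theorem hatDual_sharp (α : Dual I M (Sec I F V)) :
    (expFn I M (-1) • P.const).sharp (formConst α) = expFn I M (-1) • secConst (P.sharp α) := by
  change expFn I M (-1) • P.const.sharp (formConst α) = _
  rw [P.const_sharp]

/-- The anchor of `Â*` at `α` is `e^{-t} (ρ(P^♯ α) + ⟨X₀, α⟩ ∂/∂t)`, where
`⟨X₀, α⟩ = ⟨φ, P^♯ α⟩` for `X₀ = -P^♯ φ`. -/
theorem hatDual_anchor (α : Dual I M (Sec I F V)) :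
    (A.hatDual φ P).anchor (formConst α) =
      expFn I M (-1) • liftVF ((A.dual φ P).anchor α) (φ (P.sharp α)) := by
  change (A.hat φ).anchor ((expFn I M (-1) • P.const).sharp (formConst α)) = _
  rw [hatDual_sharp, map_smul, hat_anchor_secConst]
  rfl

/-- On `1`-forms of `A`, the bracket of `Â*` is
`e^{-t} ([α, β]_P - ⟨X₀, α⟩ β + ⟨X₀, β⟩ α)`: the derivatives of `e^{-t}` along `∂/∂t` and the
`φ`-terms of `[α, β]_P` account for the correction. -/
theorem hatDual_bracket (α β : Dual I M (Sec I F V)) :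
    (A.hatDual φ P).bracket (formConst α) (formConst β) =
      expFn I M (-1) • formConst ((A.dual φ P).bracket α β - φ (P.sharp α) • β
        + φ (P.sharp β) • α) := by
  refine (secTimeExt I F V).dual_ext fun Y => ?_
  change (A.hat φ).lieTw 0 ((expFn I M (-1) • P.const).sharp (formConst α)) (formConst β)
      (secConst Y) -
    (A.hat φ).lieTw 0 ((expFn I M (-1) • P.const).sharp (formConst β)) (formConst α) (secConst Y) -
    (((A.hat φ).anchor (secConst Y)).deriv
      (formConst β ((expFn I M (-1) • P.const).sharp (formConst α))) +
        formConst β ((expFn I M (-1) • P.const).sharp (formConst α)) * 0) =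
    expFn I M (-1) * formConst _ (secConst Y)
  have h : (A.dual φ P).bracket α β Y = (A.anchor (P.sharp α)).deriv (β Y)
        - β (A.bracket (P.sharp α) Y) + φ (P.sharp α) * β Y -
      ((A.anchor (P.sharp β)).deriv (α Y) - α (A.bracket (P.sharp β) Y) + φ (P.sharp β) * α Y) -
      ((A.anchor Y).deriv (β (P.sharp α)) + β (P.sharp α) * φ Y) := by
    rw [← lieTw_apply, ← lieTw_apply]
    rfl
  have hs : fnConst (α (P.sharp β)) = - fnConst (β (P.sharp α)) := congrArg fnConst (P.skew β α)
  simp only [hatDual_sharp, lieTw_apply, LinearMap.zero_apply, zero_mul, mul_zero, add_zero,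
    map_smul, map_sub, VF.smul_deriv, smul_bracket, hat_anchor_secConst, hat_bracket_const,
    formConst_secConst, liftVF_deriv_fnConst, smul_eq_mul, VF.deriv_mul, liftVF_deriv_expFn,
    LinearMap.add_apply, LinearMap.sub_apply, LinearMap.smul_apply, h, hs, fnConst_add,
    fnConst_sub, fnConst_mul, neg_smul, one_smul, map_neg]
  ring

/-- The Lie derivative on `Â*` of a `1`-form on `A*`. -/
theorem hatDual_lieDual (α : Dual I M (Sec I F V)) (θ : Dual I M (Dual I M (Sec I F V))) :
    (A.hatDual φ P).lieDual (formConst α) (constBidual θ) =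
      expFn I M (-1) • constBidual ((A.dual φ P).lieDual α θ + φ (P.sharp α) • θ
        - θ α • toBidual (-P.sharp φ)) := by
  refine (secTimeExt I F V).dual.dual_ext fun β => ?_
  change (A.hatDual φ P).lieDual (formConst α) (constBidual θ) (formConst β) =
    expFn I M (-1) * constBidual _ (formConst β)
  have h : toBidual (-P.sharp φ) β = φ (P.sharp β) := by
    change β (-P.sharp φ) = _
    rw [map_neg, ← P.skew]
  simp only [lieDual_apply, hatDual_anchor, hatDual_bracket, constBidual_formConst, map_smul,
    VF.smul_deriv, liftVF_deriv_fnConst, LinearMap.add_apply, LinearMap.sub_apply,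
    LinearMap.smul_apply, smul_eq_mul, h, map_add, map_sub, fnConst_add, fnConst_sub, fnConst_mul]
  ring

/-- The Lie derivative on `Â*` of `e^{ct} ν`, for a multivector `ν` of top degree on `A*`. -/
theorem hatDual_lieMultivector {n : ℕ} (hn : Module.finrank ℝ F = n) (c : ℝ)
    (α : Dual I M (Sec I F V)) (ν : Multivector I M (Dual I M (Sec I F V)) n)
    (θ : Fin n → Dual I M (Dual I M (Sec I F V))) :
    (A.hatDual φ P).lieMultivector (formConst α) (expFn I M c • constMultivector ν)
        (fun i => constBidual (θ i)) =
      expFn I M (-1) * expFn I M c * (fnConst ((A.dual φ P).lieMultivector α ν θ) +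
        (c - n + 1) • fnConst (φ (P.sharp α) * ν θ)) := by
  have hS : HasLocalFrames I M n (Dual I M (Dual I M (Sec I F V))) :=
    hn ▸ (hasLocalFrames_sec F V).dual.dual
  have h1 : φ (P.sharp α) = toBidual (-P.sharp φ) α := by
    change _ = α (-P.sharp φ)
    rw [map_neg, ← P.skew]
  -- the trace of `β ↦ ⟨X₀, β⟩ α`
  have h2 := hS.sum_mul_map_update ν (LinearMap.applyₗ α) (toBidual (-P.sharp φ)) θ
  change ∑ i, θ i α * _ = toBidual (-P.sharp φ) α * _ at h2
  have h4 (i : Fin n) (f : FnT I M) (ζ : Dual I M (Dual I M (Sec I F V))) :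
      constMultivector ν (Function.update (fun j => constBidual (θ j)) i (f • constBidual ζ)) =
        f * fnConst (ν (Function.update θ i ζ)) :=
    (secTimeExt I F V).dual.dual.constForm_update_smul ν θ i f ζ
  have h5 : ∑ i, ν (Function.update θ i ((A.dual φ P).lieDual α (θ i) + φ (P.sharp α) • θ i
        - θ i α • toBidual (-P.sharp φ))) =
      ∑ i, ν (Function.update θ i ((A.dual φ P).lieDual α (θ i))) +
        ((n : ℝ) - 1) • (φ (P.sharp α) * ν θ) := by
    simp only [ν.map_update_sub, ν.map_update_add, ν.map_update_smul, smul_eq_mul,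
      Finset.sum_add_distrib, Finset.sum_sub_distrib, h2, Function.update_eq_self,
      Finset.sum_const, Finset.card_univ, Fintype.card_fin, ← h1, sub_smul, one_smul,
      Nat.cast_smul_eq_nsmul, add_sub_assoc]
  have h6 (a : ℝ) (f : Fn I M) : fnConst (a • f) = a • fnConst f := rfl
  change ((A.hatDual φ P).anchor (formConst α)).deriv
      (expFn I M c * constMultivector ν fun i => constBidual (θ i)) -
    ∑ i, expFn I M c * constMultivector ν (Function.update (fun j => constBidual (θ j)) i
      ((A.hatDual φ P).lieDual (formConst α) (constBidual (θ i)))) =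
    _ * (fnConst (((A.dual φ P).anchor α).deriv (ν θ) -
      ∑ i, ν (Function.update θ i ((A.dual φ P).lieDual α (θ i)))) + _)
  simp only [hatDual_lieDual, hatDual_anchor, constMultivector_constBidual, h4,
    ← Finset.mul_sum, ← fnConst_sum, h5, VF.smul_deriv, VF.deriv_mul, liftVF_deriv_fnConst,
    liftVF_deriv_expFn, fnConst_add,
    fnConst_sub, fnConst_mul, h6, sub_smul, add_smul, one_smul]
  simp only [Algebra.smul_def]
  ring

/-- The Lie derivative on `M × ℝ` of `μ ∧ dt` along the anchor of `Â*`, for a form `μ` of top degree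
on `M`. -/
theorem hatDual_lieForm_wedgeTime {m : ℕ} (hm : Module.finrank ℝ E = m)
    (α : Dual I M (Sec I F V)) (μ : Form I M (VF I M) m) (Z : Fin m → VF I M) :
    (tangentAlgebroid (I.prod 𝓘(ℝ, ℝ)) (M × ℝ)).lieForm ((A.hatDual φ P).anchor (formConst α))
        (wedgeTime μ) (liftFrame Z) =
      expFn I M (-1) * fnConst ((tangentAlgebroid I M).lieForm ((A.dual φ P).anchor α) μ Z -
        φ (P.sharp α) * μ Z) := by
  have hV : HasLocalFrames (I.prod 𝓘(ℝ, ℝ)) (M × ℝ) (m + 1) (VFT I M) :=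
    hm ▸ hasLocalFrames_vf_time
  have h : ((tangentAlgebroid (I.prod 𝓘(ℝ, ℝ)) (M × ℝ)).anchor
      (liftVF ((A.dual φ P).anchor α) (φ (P.sharp α)))).deriv (expFn I M (-1)) = _ :=
    liftVF_deriv_expFn _ _ _
  -- pulling `e^{-t}` out of the vector field produces its divergence term
  rw [hatDual_anchor, smul_lieForm _ hV, h, lieForm_liftVF_wedgeTime, wedgeTime_liftFrame,
    fnConst_sub, fnConst_mul, neg_smul, one_smul]
  ring

/-- The modular form of `Â*` with respect to `e^{ct} ν ⊗ (μ ∧ dt)` in terms of that of `A*`. -/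
theorem constBidual_modularForm {n m : ℕ} (hn : Module.finrank ℝ F = n)
    (hm : Module.finrank ℝ E = m) (c : ℝ)
    {ν : Multivector I M (Dual I M (Sec I F V)) n} (hν : Form.NowhereZero ν)
    {μ : Form I M (VF I M) m} (hμ : Form.NowhereZero μ)
    {ξ : Dual I M (Dual I M (Sec I F V))} (hξ : IsModularForm (A.dual φ P) ν μ ξ)
    {ξ' : Dual (I.prod 𝓘(ℝ, ℝ)) (M × ℝ) (Dual (I.prod 𝓘(ℝ, ℝ)) (M × ℝ) (SecT I F V))}
    (hξ' : IsModularForm (A.hatDual φ P) (expFn I M c • constMultivector ν) (wedgeTime μ) ξ') :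
    expFn I M 1 • ξ' = constBidual ξ + (c - n) • constBidual (toBidual (-P.sharp φ)) := by
  refine (secTimeExt I F V).dual.dual_ext fun α => ?_
  change expFn I M 1 * ξ' (formConst α) = constBidual ξ (formConst α) +
    (c - n) • constBidual (toBidual (-P.sharp φ)) (formConst α)
  have h1 : toBidual (-P.sharp φ) α = φ (P.sharp α) := by
    change α (-P.sharp φ) = _
    rw [map_neg, ← P.skew]
  rw [constBidual_formConst, constBidual_formConst, h1]
  -- the defining equations are evaluated where `ν ⊗ μ` does not vanish
  ext p
  obtain ⟨⟨θ, Z⟩, hθ⟩ := hν.exists_mul_ne_zero hμ p.1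
  have e1 := hξ' (formConst α) (fun i => constBidual (θ i)) (liftFrame Z)
  have e2 := congrArg fnConst (hξ α θ Z)
  rw [hatDual_lieMultivector A φ P hn, hatDual_lieForm_wedgeTime A φ P hm, wedgeTime_liftFrame,
    AlternatingMap.smul_apply, constMultivector_constBidual] at e1
  simp only [fnConst_add, fnConst_sub, fnConst_mul, smul_eq_mul, Algebra.smul_def, map_sub,
    map_add, map_one] at e1 e2 ⊢
  have e3 : expFn I M 1 * expFn I M (-1) = 1 := by
    rw [expFn_mul_expFn, add_neg_cancel, expFn_zero]
  have e4 : expFn I M c * expFn I M (-c) = 1 := by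
    rw [expFn_mul_expFn, add_neg_cancel, expFn_zero]
  have e5 : fnConst (ν θ * μ Z) * (expFn I M 1 * ξ' (formConst α)) = fnConst (ν θ * μ Z) *
      (fnConst (ξ α) + (algebraMap ℝ (FnT I M) c - algebraMap ℝ (FnT I M) n) *
        fnConst (φ (P.sharp α))) := by
    rw [fnConst_mul]
    let R : FnT I M := fnConst ((A.dual φ P).lieMultivector α ν θ) * fnConst (μ Z) +
      fnConst (ν θ) * fnConst ((tangentAlgebroid I M).lieForm ((A.dual φ P).anchor α) μ Z) +
      (algebraMap ℝ (FnT I M) c - algebraMap ℝ (FnT I M) n) * fnConst (φ (P.sharp α)) *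
        (fnConst (ν θ) * fnConst (μ Z))
    linear_combination expFn I M 1 * expFn I M (-c) * e1 - e2 +
      expFn I M c * expFn I M (-c) * R * e3 +
      (R - fnConst (ν θ) * fnConst (μ Z) * expFn I M 1 * ξ' (formConst α)) * e4
  exact mul_left_cancel₀ hθ (congrArg (fun f : FnT I M => f p) e5)

end AlmostLieAlgebroid

end HatDual

end LieAlgd

end

/-! ### The two identities -/

theorem mainTheorem11 {m n : ℕ}
    {M : Type*} [TopologicalSpace M] [ChartedSpace (EuclideanSpace ℝ (Fin m)) M]
    [IsManifold (𝓡 m) ∞ M] [T2Space M]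
    {F : Type*} [NormedAddCommGroup F] [NormedSpace ℝ F] [FiniteDimensional ℝ F]
    (hF : Module.finrank ℝ F = n)
    {V : M → Type*} [TopologicalSpace (TotalSpace F V)]
    [∀ x, AddCommGroup (V x)] [∀ x, Module ℝ (V x)] [∀ x, TopologicalSpace (V x)]
    [FiberBundle F V] [VectorBundle ℝ F V] [ContMDiffVectorBundle ∞ F V (𝓡 m)]
    (A : LieAlgd.LieAlgebroid (𝓡 m) M (LieAlgd.Sec (𝓡 m) F V))
    (φ₀ : LieAlgd.Dual (𝓡 m) M (LieAlgd.Sec (𝓡 m) F V)) (hφ₀ : A.IsCocycle φ₀)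
    (P : LieAlgd.Bivector (𝓡 m) M (LieAlgd.Sec (𝓡 m) F V)) (hP : A.IsJacobiBivector φ₀ P)
    (ν : LieAlgd.Multivector (𝓡 m) M (LieAlgd.Dual (𝓡 m) M (LieAlgd.Sec (𝓡 m) F V)) n)
    (hν : LieAlgd.Form.NowhereZero ν)
    (μ : LieAlgd.Form (𝓡 m) M (LieAlgd.VF (𝓡 m) M) m) (hμ : LieAlgd.Form.NowhereZero μ) :
    -- the three modular forms exist and are unique
    (∃! ξ, LieAlgd.IsModularForm (A.dual φ₀ P) ν μ ξ) ∧
    (∃! ξ₁, LieAlgd.IsModularForm (A.hatDual φ₀ P)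
      (LieAlgd.expFn (𝓡 m) M n • LieAlgd.constMultivector ν) (LieAlgd.wedgeTime μ) ξ₁) ∧
    (∃! ξ₂, LieAlgd.IsModularForm (A.hatDual φ₀ P)
      (LieAlgd.constMultivector ν) (LieAlgd.wedgeTime μ) ξ₂) ∧
    -- the modular form of the Lie algebroid `A*`
    (∀ ξ ξ₁, LieAlgd.IsModularForm (A.dual φ₀ P) ν μ ξ →
      LieAlgd.IsModularForm (A.hatDual φ₀ P)
        (LieAlgd.expFn (𝓡 m) M n • LieAlgd.constMultivector ν) (LieAlgd.wedgeTime μ) ξ₁ →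
      LieAlgd.constBidual ξ = LieAlgd.expFn (𝓡 m) M 1 • ξ₁) ∧
    -- the modular form of the Jacobi algebroid `(A*, X₀)`, where `X₀ = - P^♯ φ₀`
    (∀ ξ ξ₂, LieAlgd.IsJacobiModularForm (A.dual φ₀ P) (LieAlgd.toBidual (-P.sharp φ₀)) ν μ ξ →
      LieAlgd.IsModularForm (A.hatDual φ₀ P)
        (LieAlgd.constMultivector ν) (LieAlgd.wedgeTime μ) ξ₂ →
      LieAlgd.constBidual ξ = LieAlgd.expFn (𝓡 m) M 1 • ξ₂ +
        LieAlgd.constBidual (LieAlgd.toBidual (-P.sharp φ₀))) := by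
  have hm : Module.finrank ℝ (EuclideanSpace ℝ (Fin m)) = m := finrank_euclideanSpace_fin
  have hS : LieAlgd.HasLocalFrames (𝓡 m) M n (LieAlgd.Sec (𝓡 m) F V) :=
    hF ▸ LieAlgd.hasLocalFrames_sec F V
  have hV : LieAlgd.HasLocalFrames (𝓡 m) M m (LieAlgd.VF (𝓡 m) M) := by
    have := LieAlgd.hasLocalFrames_vf (I := 𝓡 m) (M := M)
    rwa [hm] at this
  have hVT : LieAlgd.HasLocalFrames ((𝓡 m).prod 𝓘(ℝ, ℝ)) (M × ℝ) (m + 1)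
      (LieAlgd.VFT (𝓡 m) M) := by
    have := LieAlgd.hasLocalFrames_vf_time (I := 𝓡 m) (M := M)
    rwa [hm] at this
  have hexists (c : ℝ) : ∃! ξ, LieAlgd.IsModularForm (A.hatDual φ₀ P)
      (LieAlgd.expFn (𝓡 m) M c • LieAlgd.constMultivector ν) (LieAlgd.wedgeTime μ) ξ :=
    LieAlgd.existsUnique_isModularForm _
      (hF ▸ (LieAlgd.secTimeExt (𝓡 m) F V).dual.hasLocalFrames_time)
      hVT (LieAlgd.exp_smul_constMultivector_nowhereZero c hν)
      (LieAlgd.wedgeTime_nowhereZero hμ)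
  -- `ν` itself is the case `c = 0` of `e^{ct} ν`
  have h0 : LieAlgd.expFn (𝓡 m) M 0 • LieAlgd.constMultivector ν = LieAlgd.constMultivector ν := by
    rw [LieAlgd.expFn_zero, one_smul]
  refine ⟨LieAlgd.existsUnique_isModularForm _ hS.dual hV hν hμ, hexists n, h0 ▸ hexists 0,
    fun ξ ξ₁ hξ hξ₁ => ?_, ?_⟩
  · rw [LieAlgd.AlmostLieAlgebroid.constBidual_modularForm _ φ₀ P hF hm n hν hμ hξ hξ₁, sub_self,
      zero_smul, add_zero]
  · rintro _ ξ₂ ⟨ξ, hξ, rfl⟩ hξ₂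
    rw [← h0] at hξ₂
    rw [LieAlgd.AlmostLieAlgebroid.constBidual_modularForm _ φ₀ P hF hm 0 hν hμ hξ hξ₂]
    have h : LieAlgd.constBidual (ξ - ((n : LieAlgd.Fn (𝓡 m) M) - 1) •
        LieAlgd.toBidual (-P.sharp φ₀)) = LieAlgd.constBidual ξ -
        ((n : ℝ) - 1) • LieAlgd.constBidual (LieAlgd.toBidual (-P.sharp φ₀)) := by
      have hc : (n : LieAlgd.Fn (𝓡 m) M) - 1 = algebraMap ℝ _ ((n : ℝ) - 1) := by
        rw [map_sub, map_one, map_natCast]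
      rw [← LieAlgd.constBidual_smul, ← LieAlgd.constBidual_sub, hc]
      rfl
    rw [h]
    module
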